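/- **Setting.** Let $n\ge 4$, let $F=\mathbb{Q}(l,r)$ be the field of rational functions in two indeterminates $l,r$, and put $m=\frac1r-r$. Number the nodes of the Dynkin diagram of type $D_n$ so that $2-3-\cdots-n$ is a path and node $1$ is joined to node $3$ only; write $i\sim j$ for adjacent nodes. The Artin group $\mathcal{A}(D_n)$ has generators $s_1,\dots,s_n$ and relations $s_is_js_i=s_js_is_j$ if $i\sim j$ and $s_is_j=s_js_i$ otherwise. The CGW algebra $CGW(D_n)$ is the associative unital $F$-algebra with generators $g_1,\dots,g_n,e_1,\dots,e_n$ and relations $$g_ig_jg_i=g_jg_ig_j\ (i\sim j),\qquad g_ig_j=g_jg_i\ (i\not\sim j),\qquad m\,e_i=l\,(g_i^2+m\,g_i-1),\qquad g_ie_i=\tfrac1l e_i,\qquad e_ig_je_i=l\,e_i\ (i\sim j).$$ Let $V_n$ be the $F$-vector space with basis $w_{st},\widehat{w_{st}}$ $(1\le s<t\le n)$; write $\overline{w_{st}}$ for either of $w_{st},\widehat{w_{st}}$. Define endomorphisms $\nu_1,\dots,\nu_n$ of $V_n$ as follows. For $\nu_1$: $$\begin{aligned} \nu_1(\widehat{w_{ij}})&=m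 r^{j-5}(\widehat{w_{1i}}-w_{1i})+m r^{j-4}(\widehat{w_{2i}}-w_{2i})+m r^{i-3}(\widehat{w_{1j}}-w_{1j})+m r^{i-2}(\widehat{w_{2j}}-w_{2j})\\ &\quad+m^2(r^{i+j-8}+r^{i+j-6})(\widehat{w_{12}}-w_{12})+r\,\widehat{w_{ij}}&&(3\le i<j\le n),\\ \nu_1(\widehat{w_{1j}})&=w_{2j}&&(j\ge3),\\ \nu_1(\widehat{w_{2j}})&=w_{1j}+m r^{j-3}w_{12}-m\,w_{2j}&&(j\ge3),\\ \nu_1(w_{2j})&=\widehat{w_{1j}}+m r^{j-3}\widehat{w_{12}}-m\,w_{2j}&&(j\ge3),\\ \nu_1(w_{1j})&=\widehat{w_{2j}}+m r^{j-4}(\widehat{w_{12}}-w_{12})+m(\widehat{w_{1j}}-w_{1j})&&(j\ge3),\\ \nu_1(\widehat{w_{12}})&=\tfrac1l\widehat{w_{12}}, \end{aligned}$$ and $\nu_1(\overline{w_{st}})=r\,\overline{w_{st}}$ in all other cases. For $\nu_k$ with $2\le k\le n$: $$\begin{aligned} \nu_{s+1}(\overline{w_{s,t}})&=\overline{w_{s+1,t}}&&(t\ge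 s+2),\\ \nu_{t+1}(\overline{w_{s,t}})&=\overline{w_{s,t+1}}&&(t+1\le n),\\ \nu_{s+1}(\widehat{w_{s,s+1}})&=r\,\widehat{w_{s,s+1}},\qquad \nu_{s+1}(w_{s,s+1})=\tfrac1l w_{s,s+1},\\ \nu_s(\widehat{w_{s,t}})&=\widehat{w_{s-1,t}}+\tfrac ml r^{t-s-2}w_{s-1,s}-m\,\widehat{w_{s,t}}&&(s\ge2),\\ \nu_t(\widehat{w_{s,t}})&=\widehat{w_{s,t-1}}+\tfrac{m}{l\,r^{t-s-2}}w_{t-1,t}-m\,\widehat{w_{s,t}}&&(s\le t-2),\\ \nu_s(w_{s,t})&=w_{s-1,t}+m r^{t-s-1}w_{s-1,s}-m\,w_{s,t}&&(s\ge2),\\ \nu_t(w_{s,t})&=w_{s,t-1}+\tfrac{m}{l\,r^{t-s-2}}w_{t-1,t}-m\,w_{s,t}&&(s\le t-2), \end{aligned}$$ and $\nu_k(\overline{w_{st}})=r\,\overline{w_{st}}$ in all other cases. **The Cohen–Wales representation.** Realise the positive roots of type $D_n$ in $\mathbb{Z}^n$ as $\varepsilon_j-\varepsilon_i$ and $\varepsilon_j+\varepsilon_i$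 ($1\le i<j\le n$), with simple roots $\alpha_1=\varepsilon_1+\varepsilon_2$ and $\alpha_k=\varepsilon_k-\varepsilon_{k-1}$ ($k\ge2$), and index the basis of $V_n$ by positive roots through $x_{\varepsilon_j-\varepsilon_i}=w_{ij}$, $x_{\varepsilon_j+\varepsilon_i}=\widehat{w_{ij}}$. For parameters $t,q\in F^\times$ the Cohen–Wales representation of $\mathcal A(D_n)$ with parameters $t,q$ sends $s_k$ to $$\sigma_k(x_\beta)=\tau_k(x_\beta)+t\,T_{k,\beta}(q)\,x_{\alpha_k},\qquad \tau_k(x_\beta)=\begin{cases}0&(\alpha_k,\beta)=2\\ q\,x_{\beta-\alpha_k}&(\alpha_k,\beta)=1\\ x_\beta&(\alpha_k,\beta)=0\\ (1-q^2)x_\beta+q\,x_{\beta+\alpha_k}&(\alpha_k,\beta)=-1,\end{cases}$$ where the $T_{k,\beta}\in\mathbb{Z}[q]$ are the polynomials of Cohen and Wales (the unique ones with $T_{k,\alpha_k}=q^4$ for which this is a representation for indeterminate $t$ and $q$). Explicitly, for $\beta=\varepsilon_j-\varepsilon_i$, of height $d=j-i$: $T_{k,\beta}=0$ if $k\le i$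 or $k>j$; $q^4$ if $k=i+1=j$; $q^{d+1}(q^2-1)$ if $k=i+1<j$ or $k=j>i+1$; $q^{d-1}(q^2-1)^2$ if $i+1<k<j$. For $\beta=\varepsilon_j+\varepsilon_i$, of height $d=i+j-2$: $T_{1,\beta}$ is $q^4$ if $j=2$, $q^{d+1}(q^2-1)$ if $i\le2<j$, and $q^{d-3}(q^2-1)^2(q^2+1)$ if $i\ge3$; and for $k\ge2$, $T_{k,\beta}$ is $0$ if $k>j$; $q^2(q^2-1)(q^{2(k-2)}-1)$ if $k=i+1=j$; $q^{j-k}(q^2-1)^2(q^{2(k-2)}-1)$ if $k=i+1<j$; $q^{d+1}(q^2-1)$ if $k=i$ or $k=j>i+1$; $q^{d-3}(q^2-1)^2(q^2+1)$ if $k<i$; and $q^{d-1}(q^2-1)^2$ if $i+1<k<j$. **Theorem 1.** The space $V_n$ has dimension $n^2-n$, and $g_k\mapsto\nu_k$ $(1\le k\le n)$ defines a representation $\nu^{(n)}:CGW(D_n)\to\mathrm{End}_F(V_n)$. Moreover, $s_k\mapsto g_k$ defines a homomorphism from $\mathcal A(D_n)$ to the multiplicative monoid of $CGW(D_n)$,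 and, with $l=r^3t^{-1}$ (that is, $t=r^3l^{-1}$), the representation of $\mathcal A(D_n)$ on $V_n$ obtained from $\nu^{(n)}$ by rescaling the generators, $s_k\mapsto r^{-1}\nu_k$, is equivalent over $F$ to the Cohen–Wales representation of $\mathcal A(D_n)$ with parameters $t$ and $r^{-1}$. -/

import Mathlib

noncomputable section

namespace CGWTypeD

/-! ### The Dynkin diagram, the Artin group and the CGW algebra of type `D_n` -/

/-- The nodes `1, …, n` of the Dynkin diagram of type `D_n`. -/
def Node (n : ℕ) : Type := {k : ℕ // 1 ≤ k ∧ k ≤ n}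

/-- Adjacency of nodes: `2 - 3 - ⋯ - n` is a path and the node `1` is joined to the node `3` only. -/
def Adj (i j : ℕ) : Prop :=
  (2 ≤ i ∧ j = i + 1) ∨ (2 ≤ j ∧ i = j + 1) ∨ (i = 1 ∧ j = 3) ∨ (i = 3 ∧ j = 1)

/-- The defining relators of the Artin group of type `D_n`. -/
inductive IsArtinRelator (n : ℕ) : FreeGroup (Node n) → Prop
  | comm (i j : Node n) (h : ¬ Adj i.1 j.1) :
      IsArtinRelator n
        (FreeGroup.of i * FreeGroup.of j * (FreeGroup.of j * FreeGroup.of i)⁻¹)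
  | braid (i j : Node n) (h : Adj i.1 j.1) :
      IsArtinRelator n
        (FreeGroup.of i * FreeGroup.of j * FreeGroup.of i *
          (FreeGroup.of j * FreeGroup.of i * FreeGroup.of j)⁻¹)

/-- The Artin group `𝒜(D_n)`. -/
abbrev Artin (n : ℕ) : Type := PresentedGroup {x | IsArtinRelator n x}

/-- The standard generator of the Artin group attached to the node `k`. -/
def Artin.s {n : ℕ} (k : Node n) : Artin n := PresentedGroup.of k

section Algebra

variable {F : Type} [Field F]

/-- The parameter `m = r⁻¹ - r`. -/
def mPar (r : F) : F := r⁻¹ - r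

/-- The generators `g_k` (`Sum.inl`) of the free algebra on all the `g_k` and `e_k`. -/
def freeG (F : Type) [Field F] {n : ℕ} (k : Node n) : FreeAlgebra F (Node n ⊕ Node n) :=
  FreeAlgebra.ι F (Sum.inl k)

/-- The generators `e_k` (`Sum.inr`) of the free algebra on all the `g_k` and `e_k`. -/
def freeE (F : Type) [Field F] {n : ℕ} (k : Node n) : FreeAlgebra F (Node n ⊕ Node n) :=
  FreeAlgebra.ι F (Sum.inr k)

/-- The defining relations of the CGW algebra of type `D_n` with parameters `l` and
`m = r⁻¹ - r`. -/
inductive CGWRel (n : ℕ) (l r : F) :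
    FreeAlgebra F (Node n ⊕ Node n) → FreeAlgebra F (Node n ⊕ Node n) → Prop
  | comm (i j : Node n) (h : ¬ Adj i.1 j.1) :
      CGWRel n l r (freeG F i * freeG F j) (freeG F j * freeG F i)
  | braid (i j : Node n) (h : Adj i.1 j.1) :
      CGWRel n l r (freeG F i * freeG F j * freeG F i) (freeG F j * freeG F i * freeG F j)
  | quad (i : Node n) :
      CGWRel n l r (mPar r • freeE F i)
        (l • (freeG F i ^ 2 + mPar r • freeG F i - 1))
  | deloop (i : Node n) :
      CGWRel n l r (freeG F i * freeE F i) (l⁻¹ • freeE F i)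
  | deloop_adj (i j : Node n) (h : Adj i.1 j.1) :
      CGWRel n l r (freeE F i * freeG F j * freeE F i) (l • freeE F i)

/-- The CGW algebra of type `D_n` with parameters `l` and `m = r⁻¹ - r`. -/
abbrev CGW (n : ℕ) (l r : F) : Type := RingQuot (CGWRel n l r)

/-- The generator `g_k` of the CGW algebra. -/
def CGW.g {n : ℕ} (l r : F) (k : Node n) : CGW n l r :=
  RingQuot.mkAlgHom F (CGWRel n l r) (freeG F k)

end Algebra

/-! ### The Cohen-Wales space -/

/-- The labels of the spanning vectors: `⟨(s, t, false), _⟩` stands for `w_{st}` and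
`⟨(s, t, true), _⟩` stands for `ŵ_{st}`, where `1 ≤ s < t ≤ n`. -/
def Label (n : ℕ) : Type := {b : ℕ × ℕ × Bool // 1 ≤ b.1 ∧ b.1 < b.2.1 ∧ b.2.1 ≤ n}

/-- The Cohen-Wales space `V_n`, with basis the `w_{st}` and the `ŵ_{st}`. -/
abbrev V (F : Type) [Field F] (n : ℕ) : Type := Label n →₀ F

section Space

variable {F : Type} [Field F]

/-- The basis vector `w_{st}` (for `h = false`) or `ŵ_{st}` (for `h = true`) of `V_n`. It is used
only for `1 ≤ s < t ≤ n`. -/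
def wbar (F : Type) [Field F] (n : ℕ) (h : Bool) (s t : ℕ) : V F n :=
  if hst : 1 ≤ s ∧ s < t ∧ t ≤ n then Finsupp.single ⟨(s, t, h), hst⟩ 1 else 0

/-- The basis vector `w_{st}`. -/
def w (F : Type) [Field F] (n s t : ℕ) : V F n := wbar F n false s t

/-- The basis vector `ŵ_{st}`. -/
def wh (F : Type) [Field F] (n s t : ℕ) : V F n := wbar F n true s t

/-- The image of `w_{st}` (`h = false`) or `ŵ_{st}` (`h = true`) under `ν_1`. -/
def nuOne (n : ℕ) (l r : F) (h : Bool) (s t : ℕ) : V F n :=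
  let m := mPar r
  if h = true ∧ 3 ≤ s then
    (m * r ^ ((t : ℤ) - 5)) • (wh F n 1 s - w F n 1 s)
      + (m * r ^ ((t : ℤ) - 4)) • (wh F n 2 s - w F n 2 s)
      + (m * r ^ ((s : ℤ) - 3)) • (wh F n 1 t - w F n 1 t)
      + (m * r ^ ((s : ℤ) - 2)) • (wh F n 2 t - w F n 2 t)
      + (m ^ 2 * (r ^ ((s : ℤ) + t - 8) + r ^ ((s : ℤ) + t - 6))) • (wh F n 1 2 - w F n 1 2)
      + r • wh F n s t
  else if h = true ∧ s = 1 ∧ 3 ≤ t then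
    w F n 2 t
  else if h = true ∧ s = 2 ∧ 3 ≤ t then
    w F n 1 t + (m * r ^ ((t : ℤ) - 3)) • w F n 1 2 - m • w F n 2 t
  else if h = false ∧ s = 2 ∧ 3 ≤ t then
    wh F n 1 t + (m * r ^ ((t : ℤ) - 3)) • wh F n 1 2 - m • w F n 2 t
  else if h = false ∧ s = 1 ∧ 3 ≤ t then
    wh F n 2 t + (m * r ^ ((t : ℤ) - 4)) • (wh F n 1 2 - w F n 1 2)
      + m • (wh F n 1 t - w F n 1 t)
  else if h = true ∧ s = 1 ∧ t = 2 then
    l⁻¹ • wh F n 1 2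
  else
    r • wbar F n h s t

/-- The image of `w_{st}` (`h = false`) or `ŵ_{st}` (`h = true`) under `ν_k`, where `k ≥ 2`. -/
def nuTwo (n : ℕ) (l r : F) (k : ℕ) (h : Bool) (s t : ℕ) : V F n :=
  let m := mPar r
  if k = s + 1 ∧ s + 2 ≤ t then
    wbar F n h (s + 1) t
  else if k = t + 1 then
    wbar F n h s (t + 1)
  else if k = s + 1 ∧ t = s + 1 ∧ h = true then
    r • wh F n s t
  else if k = s + 1 ∧ t = s + 1 ∧ h = false then
    l⁻¹ • w F n s t
  else if k = s ∧ h = true then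
    wh F n (s - 1) t + (m / l * r ^ ((t : ℤ) - s - 2)) • w F n (s - 1) s - m • wh F n s t
  else if k = t ∧ s + 2 ≤ t ∧ h = true then
    wh F n s (t - 1) + (m / (l * r ^ ((t : ℤ) - s - 2))) • w F n (t - 1) t - m • wh F n s t
  else if k = s ∧ h = false then
    w F n (s - 1) t + (m * r ^ ((t : ℤ) - s - 1)) • w F n (s - 1) s - m • w F n s t
  else if k = t ∧ s + 2 ≤ t ∧ h = false then
    w F n s (t - 1) + (m / (l * r ^ ((t : ℤ) - s - 2))) • w F n (t - 1) t - m • w F n s t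
  else
    r • wbar F n h s t

/-- The endomorphism `ν_k` of `V_n`. -/
def nu (n : ℕ) (l r : F) (k : Node n) : Module.End F (V F n) :=
  Finsupp.linearCombination F fun b : Label n =>
    if k.1 = 1 then nuOne n l r b.1.2.2 b.1.1 b.1.2.1
    else nuTwo n l r k.1 b.1.2.2 b.1.1 b.1.2.1

/-! ### The Cohen-Wales representation

The root lattice of type `D_n` is realised in `ℤⁿ` with orthonormal basis `ε_1, …, ε_n`, with
simple roots `α_1 = ε_1 + ε_2` and `α_k = ε_k - ε_{k-1}` for `2 ≤ k ≤ n`. The positive roots are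
`ε_t - ε_s = α_{s+1} + ⋯ + α_t`, labelled like `w_{st}`, and `ε_t + ε_s`, labelled like `ŵ_{st}`,
for `1 ≤ s < t ≤ n`. The basis vector `x_β` attached to the positive root `β` is the basis vector
of `V_n` with the label of `β`. -/

/-- The positive root with a given label: `ε_t - ε_s` for `w_{st}` and `ε_t + ε_s` for `ŵ_{st}`. -/
def root {n : ℕ} (b : Label n) : ℕ → ℤ :=
  if b.1.2.2 then Pi.single b.1.2.1 1 + Pi.single b.1.1 1
  else Pi.single b.1.2.1 1 - Pi.single b.1.1 1

/-- The simple root `α_k`. -/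
def simpleRoot (k : ℕ) : ℕ → ℤ :=
  if k = 1 then Pi.single 2 1 + Pi.single 1 1 else Pi.single k 1 - Pi.single (k - 1) 1

/-- The standard inner product on `ℤⁿ`. -/
def ip (n : ℕ) (u v : ℕ → ℤ) : ℤ := ∑ i ∈ Finset.Icc 1 n, u i * v i

open scoped Classical in
/-- The basis vector `x_β` attached to a positive root `β` (and `0` for any other vector). -/
def xvec (F : Type) [Field F] (n : ℕ) (β : ℕ → ℤ) : V F n :=
  if h : ∃ b : Label n, root b = β then Finsupp.single h.choose 1 else 0

/-- The part `τ_k` of the Cohen-Wales representation that does not involve `t`: the vector `x_β` is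
sent to `0`, `r x_{β - α_k}`, `x_β`, `(1 - r²) x_β + r x_{β + α_k}` when `(α_k, β)` is `2`, `1`,
`0`, `-1` respectively. -/
def cwTau (n : ℕ) (r : F) (k : Node n) : Module.End F (V F n) :=
  Finsupp.linearCombination F fun b : Label n =>
    let p := ip n (simpleRoot k.1) (root b)
    if p = 2 then 0
    else if p = 1 then r • xvec F n (root b - simpleRoot k.1)
    else if p = 0 then xvec F n (root b)
    else (1 - r ^ 2) • xvec F n (root b) + r • xvec F n (root b + simpleRoot k.1)

/-- The height of the positive root with label `b`, that is, the sum of its coefficients on the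
simple roots. -/
def height {n : ℕ} (b : Label n) : ℕ :=
  if b.1.2.2 then b.1.1 + b.1.2.1 - 2 else b.1.2.1 - b.1.1

/-- The value at `r` of the polynomial `T_{k,β} ∈ ℤ[r]` of Cohen and Wales, for the positive root
`β` with label `b`. These are the unique polynomials with `T_{k,α_k} = r⁴` for which
`x_β ↦ τ_k(x_β) + t T_{k,β} x_{α_k}` satisfies the relations of the Artin group. One has
`T_{k,β} = 0` if `α_k` does not occur in `β`, and `T_{k,β} = r^{ht(β)+1} (r² - 1)` if
`(α_k, β) = 1`; the other cases are spelled out for each family of roots. -/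
def cwT {n : ℕ} (r : F) (k : ℕ) (b : Label n) : F :=
  let s := b.1.1
  let t := b.1.2.1
  let d := height b
  if b.1.2.2 = false then
    -- the root `ε_t - ε_s`
    if k ≤ s ∨ t < k then 0
    else if k = s + 1 ∧ k = t then r ^ 4
    else if k = s + 1 ∨ k = t then r ^ (d + 1) * (r ^ 2 - 1)
    else r ^ (d - 1) * (r ^ 2 - 1) ^ 2
  else if k = 1 then
    -- the root `ε_t + ε_s` and the node `1`
    if t = 2 then r ^ 4
    else if s ≤ 2 then r ^ (d + 1) * (r ^ 2 - 1)
    else r ^ (d - 3) * (r ^ 2 - 1) ^ 2 * (r ^ 2 + 1)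
  else
    -- the root `ε_t + ε_s` and a node `k ≥ 2`
    if t < k then 0
    else if k = s + 1 ∧ k = t then r ^ 2 * (r ^ 2 - 1) * (r ^ (2 * (k - 2)) - 1)
    else if k = s + 1 then r ^ (t - k) * (r ^ 2 - 1) ^ 2 * (r ^ (2 * (k - 2)) - 1)
    else if k = s ∨ k = t then r ^ (d + 1) * (r ^ 2 - 1)
    else if k < s then r ^ (d - 3) * (r ^ 2 - 1) ^ 2 * (r ^ 2 + 1)
    else r ^ (d - 1) * (r ^ 2 - 1) ^ 2

/-- The image `σ_k` of the `k`-th generator of the Artin group under the Cohen-Wales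
representation of type `D_n` with parameters `t` and `r`:
`σ_k(x_β) = τ_k(x_β) + t T_{k,β} x_{α_k}`. -/
def cw (n : ℕ) (t r : F) (k : Node n) : Module.End F (V F n) :=
  cwTau n r k +
    Finsupp.linearCombination F fun b : Label n => (t * cwT r k.1 b) • xvec F n (simpleRoot k.1)

end Space

/-! ### The base field -/

/-- The field `ℚ(l, r)` of rational functions in two indeterminates. -/
abbrev K : Type := FractionRing (MvPolynomial (Fin 2) ℚ)

/-- The indeterminate `l`. -/
def lK : K := algebraMap (MvPolynomial (Fin 2) ℚ) K (MvPolynomial.X 0)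

/-- The indeterminate `r`. -/
def rK : K := algebraMap (MvPolynomial (Fin 2) ℚ) K (MvPolynomial.X 1)

end CGWTypeD

end

noncomputable section
set_option linter.unusedSimpArgs false
set_option linter.unnecessarySeqFocus false
set_option linter.unusedTactic false
set_option linter.unreachableTactic false

namespace CGWTypeD

/-! The CGW relations are never checked directly for the operators `nu`. The Cohen–Wales operators
are shown to carry a CGW action, and the formulas for `nu` are then recovered as consequences of the
CGW relations.

Write σ_k = τ_k + t T_k ⊗ x_{α_k}, where T_k is the linear form `cwForm`. The τ_k satisfy the Artin
relations for reasons involving only inner products with two simple roots (`tau_comm`, `tau_braid`).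
The rank one terms preserve these relations because T_j τ_i = T_i τ_j for adjacent nodes, T_i τ_j =
T_i for distinct non-adjacent ones, and T_i(x_{α_j}) = 0 for j ≠ i (`cwForm_tau_adj`,
`cwForm_tau_not_adj`, `cwForm_simple_ne`). Since τ_k satisfies a Hecke relation up to rank one
(`tau_tau`), g_k = r σ_k satisfies g² = 1 - m g + φ_k ⊗ x_k, so that e_k = (l/m) φ_k ⊗ x_k.
`CGWModule` records the properties of (g, x, φ) that are needed, and `cwModule` verifies them for q
= r⁻¹ and t = r³ l⁻¹.

In any such module, raising operators applied to the x_k produce vectors u_{st} and û_{st}. Lowering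
is then the quadratic relation, whose extra term is a value of φ computed from the commutation and
braid relations. The action of g_1 follows by commuting it past the other nodes, with one use of the
braid relation between nodes 1 and 3. Hence w ↦ u, ŵ ↦ û intertwines `nu` with g (`intertwiner_nu`).

For the Cohen–Wales module this intertwiner is onto: its range is stable under the σ_k, contains
every x_{α_k}, and is closed under passing from x_β to x_{β+α_k} when (α_k, β) = -1 and β is a
positive root. Equality of dimensions makes it bijective, and transport along it yields both the
representation `nu` and the equivalence. -/

variable {F : Type} [Field F] {n : ℕ}

/-! ### Positive roots and their labels -/

/-- The vector `ε_t + ε_s` (for `h = true`) or `ε_t - ε_s` (for `h = false`). -/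
def rootVec (h : Bool) (s t : ℕ) : ℕ → ℤ :=
  if h then Pi.single t 1 + Pi.single s 1 else Pi.single t 1 - Pi.single s 1

/-- The label of the root `rootVec h s t`. -/
def mkLabel (h : Bool) (s t : ℕ) (H : 1 ≤ s ∧ s < t ∧ t ≤ n) : Label n := ⟨(s, t, h), H⟩

lemma root_mkLabel (h : Bool) (s t : ℕ) (H : 1 ≤ s ∧ s < t ∧ t ≤ n) :
    root (mkLabel h s t H) = rootVec h s t := rfl

lemma exists_mkLabel (b : Label n) : ∃ h s t H, b = mkLabel h s t H :=
  ⟨b.1.2.2, b.1.1, b.1.2.1, b.2, rfl⟩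

lemma rootVec_apply (h : Bool) (s t i : ℕ) :
    rootVec h s t i = (if i = t then 1 else 0) + (if i = s then (if h then 1 else -1) else 0) := by
  cases h <;> simp [rootVec, Pi.single_apply, sub_eq_add_neg]
  split_ifs <;> rfl

/-- If the larger indices t and t' differed, the nonzero coordinates would force t = s' and t' = s,
against s < t and s' < t'. The coordinate at s then determines s and the sign. -/
lemma root_injective : Function.Injective (root : Label n → ℕ → ℤ) := by
  intro b b' e
  obtain ⟨h, s, t, H, rfl⟩ := exists_mkLabel b
  obtain ⟨h', s', t', H', rfl⟩ := exists_mkLabel b'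
  rw [root_mkLabel, root_mkLabel] at e
  have e1 := congrFun e s
  have e2 := congrFun e t
  have e3 := congrFun e t'
  simp only [rootVec_apply, if_neg H.2.1.ne, if_neg H.2.1.ne', if_neg H'.2.1.ne',
    if_true] at e1 e2 e3
  have : s = s' ∧ t = t' ∧ h = h' := by
    have ht : t = t' := by
      by_contra hne
      rw [if_neg hne] at e2
      rw [if_neg (Ne.symm hne)] at e3
      have h2 : t = s' := by
        by_contra h2
        simp [h2] at e2
      have h3 : t' = s := by
        by_contra h3
        simp [h3] at e3
      omega
    subst ht
    rw [if_neg H.2.1.ne] at e1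
    have hs : s = s' := by
      by_contra h2
      rw [if_neg h2] at e1
      cases h <;> simp at e1
    subst hs
    refine ⟨rfl, rfl, ?_⟩
    cases h <;> cases h' <;> simp at e1 <;> rfl
  obtain ⟨rfl, rfl, rfl⟩ := this
  rfl

lemma xvec_root (b : Label n) : xvec F n (root b) = Finsupp.single b 1 := by
  have h : ∃ b' : Label n, root b' = root b := ⟨b, rfl⟩
  rw [xvec, dif_pos h, root_injective h.choose_spec]

lemma wbar_eq_single {h : Bool} {s t : ℕ} (H : 1 ≤ s ∧ s < t ∧ t ≤ n) :
    wbar F n h s t = Finsupp.single (mkLabel h s t H) 1 := dif_pos H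

lemma xvec_rootVec {h : Bool} {s t : ℕ} (H : 1 ≤ s ∧ s < t ∧ t ≤ n) :
    xvec F n (rootVec h s t) = wbar F n h s t := by
  rw [wbar_eq_single H, ← root_mkLabel h s t H, xvec_root]

/-- `β` is a positive root. -/
def IsPosRoot (n : ℕ) (β : ℕ → ℤ) : Prop := ∃ b : Label n, root b = β

lemma isPosRoot_rootVec {h : Bool} {s t : ℕ} (H : 1 ≤ s ∧ s < t ∧ t ≤ n) :
    IsPosRoot n (rootVec h s t) := ⟨mkLabel h s t H, rfl⟩

/-! ### Inner products with simple roots -/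

lemma ip_add (u v w : ℕ → ℤ) : ip n u (v + w) = ip n u v + ip n u w := by
  simp [ip, mul_add, Finset.sum_add_distrib]

lemma ip_sub (u v w : ℕ → ℤ) : ip n u (v - w) = ip n u v - ip n u w := by
  simp [ip, mul_sub, Finset.sum_sub_distrib]

lemma ip_simpleRoot_one (hn : 2 ≤ n) (v : ℕ → ℤ) : ip n (simpleRoot 1) v = v 2 + v 1 := by
  simp [ip, simpleRoot, add_mul, Finset.sum_add_distrib, Pi.single_apply, hn]
  omega

lemma ip_simpleRoot {k : ℕ} (h2 : 2 ≤ k) (hk : k ≤ n) (v : ℕ → ℤ) :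
    ip n (simpleRoot k) v = v k - v (k - 1) := by
  have h1 : k ≠ 1 := by omega
  have h3 : 1 ≤ k - 1 ∧ k - 1 ≤ n := by omega
  simp [ip, simpleRoot, h1, sub_mul, Finset.sum_sub_distrib, Pi.single_apply, hk, h3]
  omega

lemma simpleRoot_one : simpleRoot 1 = rootVec true 1 2 := by simp [simpleRoot, rootVec]

lemma simpleRoot_eq {k : ℕ} (h2 : 2 ≤ k) : simpleRoot k = rootVec false (k - 1) k := by
  have h1 : k ≠ 1 := by omega
  simp [simpleRoot, rootVec, h1]

lemma ip_simpleRoot_self (hn : 2 ≤ n) {k : ℕ} (h1 : 1 ≤ k) (hk : k ≤ n) :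
    ip n (simpleRoot k) (simpleRoot k) = 2 := by
  obtain rfl | h2 : k = 1 ∨ 2 ≤ k := by omega
  · rw [ip_simpleRoot_one hn, simpleRoot_one]; simp [rootVec_apply]
  · rw [ip_simpleRoot h2 hk, simpleRoot_eq h2]; simp only [rootVec_apply]
    simp; split_ifs <;> omega

lemma ip_simpleRoot_comm (i j : ℕ) :
    ip n (simpleRoot i) (simpleRoot j) = ip n (simpleRoot j) (simpleRoot i) := by
  simp [ip, mul_comm]

lemma ip_simpleRoot_adj {i j : ℕ} (h1 : 1 ≤ i) (hi : i ≤ n) (hj1 : 1 ≤ j) (hj : j ≤ n)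
    (h : Adj i j) : ip n (simpleRoot i) (simpleRoot j) = -1 := by
  wlog hij : i < j generalizing i j
  · rw [ip_simpleRoot_comm]
    apply this hj1 hj h1 hi <;> unfold Adj at * <;> omega
  unfold Adj at h
  rw [simpleRoot_eq (by omega : 2 ≤ j)]
  obtain rfl | h2 : i = 1 ∨ 2 ≤ i := by omega
  · obtain rfl : j = 3 := by omega
    rw [ip_simpleRoot_one (by omega)]; simp [rootVec_apply]
  · obtain rfl : j = i + 1 := by omega
    rw [ip_simpleRoot h2 hi]; simp only [rootVec_apply]
    simp; omega

lemma ip_simpleRoot_not_adj {i j : ℕ} (h1 : 1 ≤ i) (hi : i ≤ n) (hj1 : 1 ≤ j) (hj : j ≤ n)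
    (hne : i ≠ j) (h : ¬ Adj i j) : ip n (simpleRoot i) (simpleRoot j) = 0 := by
  wlog hij : i < j generalizing i j
  · rw [ip_simpleRoot_comm]
    apply this hj1 hj h1 hi <;> unfold Adj at * <;> omega
  unfold Adj at h
  rw [simpleRoot_eq (by omega : 2 ≤ j)]
  obtain rfl | h2 : i = 1 ∨ 2 ≤ i := by omega
  · rw [ip_simpleRoot_one (by omega)]; simp only [rootVec_apply]
    simp; split_ifs <;> omega
  · rw [ip_simpleRoot h2 hi]; simp only [rootVec_apply]
    simp; split_ifs <;> omega

lemma ip_rootVec_one (hn : 2 ≤ n) (h : Bool) (s t : ℕ) (hs : 1 ≤ s) (hst : s < t) :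
    ip n (simpleRoot 1) (rootVec h s t) =
      (if t = 2 then 1 else 0) + (if s ≤ 2 then (if h then 1 else -1) else 0) := by
  rw [ip_simpleRoot_one hn, rootVec_apply, rootVec_apply]
  cases h <;> simp <;> split_ifs <;> omega

lemma ip_rootVec {k : ℕ} (h2 : 2 ≤ k) (hk : k ≤ n) (h : Bool) (s t : ℕ) :
    ip n (simpleRoot k) (rootVec h s t) =
      (if k = t then 1 else 0) + (if k = s then (if h then 1 else -1) else 0)
      - ((if k = t + 1 then 1 else 0) + (if k = s + 1 then (if h then 1 else -1) else 0)) := by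
  rw [ip_simpleRoot h2 hk, rootVec_apply, rootVec_apply]
  have e1 : k - 1 = t ↔ k = t + 1 := by omega
  have e2 : k - 1 = s ↔ k = s + 1 := by omega
  simp only [e1, e2]

/-! ### The operators τ_k and their Artin relations -/

/-- The vector `τ_k(x_β)` for a positive root `β`, for an arbitrary `k`. -/
def tau (n : ℕ) (q : F) (k : ℕ) : Module.End F (V F n) :=
  Finsupp.linearCombination F fun b : Label n =>
    let p := ip n (simpleRoot k) (root b)
    if p = 2 then 0
    else if p = 1 then q • xvec F n (root b - simpleRoot k)
    else if p = 0 then xvec F n (root b)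
    else (1 - q ^ 2) • xvec F n (root b) + q • xvec F n (root b + simpleRoot k)

lemma tau_xvec (q : F) (k : ℕ) {β : ℕ → ℤ} (hβ : IsPosRoot n β) :
    tau n q k (xvec F n β) =
      if ip n (simpleRoot k) β = 2 then 0
      else if ip n (simpleRoot k) β = 1 then q • xvec F n (β - simpleRoot k)
      else if ip n (simpleRoot k) β = 0 then xvec F n β
      else (1 - q ^ 2) • xvec F n β + q • xvec F n (β + simpleRoot k) := by
  obtain ⟨b, rfl⟩ := hβ
  conv_lhs => rw [xvec_root]
  simp [tau]

/-- The inner product of a positive root with a simple root, and the resulting reflection. -/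
lemma isPosRoot_cases {k : ℕ} (hn : 2 ≤ n) (h1 : 1 ≤ k) (hk : k ≤ n) {β : ℕ → ℤ}
    (hβ : IsPosRoot n β) :
    (ip n (simpleRoot k) β = 2 ∧ β = simpleRoot k) ∨
    (ip n (simpleRoot k) β = 1 ∧ IsPosRoot n (β - simpleRoot k)) ∨
    (ip n (simpleRoot k) β = 0 ∧ IsPosRoot n β) ∨
    (ip n (simpleRoot k) β = -1 ∧ IsPosRoot n (β + simpleRoot k)) := by
  have hβ' := hβ
  obtain ⟨b, rfl⟩ := hβ
  obtain ⟨h, s, t, H, rfl⟩ := exists_mkLabel b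
  rw [root_mkLabel] at hβ' ⊢
  simp only [hβ', and_true]
  have pos : ∀ {γ : ℕ → ℤ} (h' : Bool) (s' t' : ℕ), γ = rootVec h' s' t' →
      1 ≤ s' ∧ s' < t' ∧ t' ≤ n → IsPosRoot n γ := by
    rintro γ h' s' t' rfl H'
    exact isPosRoot_rootVec H'
  obtain rfl | h2 : k = 1 ∨ 2 ≤ k := by omega
  · rw [ip_rootVec_one hn h s t H.1 H.2.1]
    obtain h3 | h3 | ⟨rfl, h3⟩ | ⟨rfl, rfl⟩ :
      3 ≤ s ∨ (s = 2 ∧ 3 ≤ t) ∨ (s = 1 ∧ 3 ≤ t) ∨ (s = 1 ∧ t = 2) := by omega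
    · rw [if_neg (by omega), if_neg (by omega)]; simp
    · obtain ⟨rfl, h3⟩ := h3
      rw [if_neg (by omega), if_pos (by omega)]
      cases h
      · refine .inr (.inr (.inr ⟨rfl, pos true 1 t ?_ (by omega)⟩))
        simp [rootVec, simpleRoot]; abel
      · refine .inr (.inl ⟨rfl, pos false 1 t ?_ (by omega)⟩)
        simp [rootVec, simpleRoot]; abel
    · rw [if_neg (by omega), if_pos (by omega)]
      cases h
      · refine .inr (.inr (.inr ⟨rfl, pos true 2 t ?_ (by omega)⟩))
        simp [rootVec, simpleRoot]
      · refine .inr (.inl ⟨rfl, pos false 2 t ?_ (by omega)⟩)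
        simp [rootVec, simpleRoot]
    · cases h <;> simp [rootVec, simpleRoot]
  · rw [ip_rootVec h2 hk]
    obtain ⟨a, rfl⟩ : ∃ a, k = a + 1 := ⟨k - 1, by omega⟩
    obtain rfl | rfl | rfl | rfl | ⟨h3, h4, h5, h6⟩ : s = a ∨ s = a + 1 ∨ t = a + 1 ∨ t = a ∨
      (s ≠ a ∧ s ≠ a + 1 ∧ t ≠ a + 1 ∧ t ≠ a) := by omega
    · obtain rfl | h3 := eq_or_ne t (s + 1)
      · cases h <;> simp [rootVec, simpleRoot]; omega
      · rw [if_neg (by omega), if_neg (by omega), if_neg (by omega), if_pos (by omega)]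
        cases h
        · refine .inr (.inl ⟨rfl, pos false (s + 1) t ?_ (by omega)⟩)
          simp [rootVec, simpleRoot, show s ≠ 0 by omega]
        · refine .inr (.inr (.inr ⟨rfl, pos true (s + 1) t ?_ (by omega)⟩))
          simp [rootVec, simpleRoot, show s ≠ 0 by omega]
    · rw [if_neg (show ¬ a + 1 = t by omega), if_pos rfl, if_neg (show ¬ a + 1 = t + 1 by omega),
        if_neg (show ¬ a + 1 = a + 1 + 1 by omega)]
      cases h
      · refine .inr (.inr (.inr ⟨rfl, pos false a t ?_ (by omega)⟩))
        simp [rootVec, simpleRoot, show a ≠ 0 by omega]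
      · refine .inr (.inl ⟨rfl, pos true a t ?_ (by omega)⟩)
        simp [rootVec, simpleRoot, show a ≠ 0 by omega]; abel
    · by_cases h3 : s = a
      · subst h3; cases h <;> simp [rootVec, simpleRoot]; omega
      · rw [if_pos (by omega), if_neg (by omega), if_neg (by omega), if_neg (by omega)]
        refine .inr (.inl ⟨rfl, pos h s a ?_ (by omega)⟩)
        cases h <;> simp [rootVec, simpleRoot, show a ≠ 0 by omega] <;> abel
    · rw [if_neg (by omega), if_neg (by omega), if_pos (by omega), if_neg (by omega)]
      refine .inr (.inr (.inr ⟨rfl, pos h s (t + 1) ?_ (by omega)⟩))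
      cases h <;> simp [rootVec, simpleRoot, show t ≠ 0 by omega] <;> abel
    · rw [if_neg (by omega), if_neg (by omega), if_neg (by omega), if_neg (by omega)]
      simp

lemma isPosRoot_simpleRoot (hn : 2 ≤ n) {k : ℕ} (h1 : 1 ≤ k) (hk : k ≤ n) :
    IsPosRoot n (simpleRoot k) := by
  obtain rfl | h2 : k = 1 ∨ 2 ≤ k := by omega
  · rw [simpleRoot_one]; exact isPosRoot_rootVec (by omega)
  · rw [simpleRoot_eq h2]; exact isPosRoot_rootVec (by omega)

lemma IsPosRoot.sub_simpleRoot (hn : 2 ≤ n) {k : ℕ} (h1 : 1 ≤ k) (hk : k ≤ n) {β : ℕ → ℤ}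
    (hβ : IsPosRoot n β) (h : ip n (simpleRoot k) β = 1) : IsPosRoot n (β - simpleRoot k) := by
  have := isPosRoot_cases hn h1 hk hβ
  simpa [h] using this

lemma IsPosRoot.add_simpleRoot (hn : 2 ≤ n) {k : ℕ} (h1 : 1 ≤ k) (hk : k ≤ n) {β : ℕ → ℤ}
    (hβ : IsPosRoot n β) (h : ip n (simpleRoot k) β = -1) : IsPosRoot n (β + simpleRoot k) := by
  have := isPosRoot_cases hn h1 hk hβ
  simpa [h] using this

section braid

variable {i j : ℕ} (q : F)

/-- For orthogonal α_i and α_j, a shift by one does not change the product with the other, so the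
two actions do not interfere. -/
lemma tau_comm (hn : 2 ≤ n) (hi1 : 1 ≤ i) (hi : i ≤ n) (hj1 : 1 ≤ j) (hj : j ≤ n)
    (hne : i ≠ j) (h : ¬ Adj i j) :
    tau n q i * tau n q j = tau n q j * tau n q i := by
  have aij := ip_simpleRoot_not_adj hi1 hi hj1 hj hne h
  have aji := aij
  rw [ip_simpleRoot_comm] at aji
  have aii := ip_simpleRoot_self hn hi1 hi
  have ajj := ip_simpleRoot_self hn hj1 hj
  have ai := fun β : ℕ → ℤ => IsPosRoot.add_simpleRoot hn hi1 hi (β := β)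
  have aj := fun β : ℕ → ℤ => IsPosRoot.add_simpleRoot hn hj1 hj (β := β)
  have si := fun β : ℕ → ℤ => IsPosRoot.sub_simpleRoot hn hi1 hi (β := β)
  have sj := fun β : ℕ → ℤ => IsPosRoot.sub_simpleRoot hn hj1 hj (β := β)
  refine Finsupp.lhom_ext' fun b => LinearMap.ext_ring ?_
  simp only [LinearMap.comp_apply, Finsupp.lsingle_apply, Module.End.mul_apply]
  rw [← xvec_root]
  generalize hb : root b = β
  have hβ : IsPosRoot n β := ⟨b, hb⟩
  clear hb b
  have e1 : β + simpleRoot j + simpleRoot i = β + simpleRoot i + simpleRoot j := add_right_comm _ _ _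
  have e2 : β - simpleRoot j - simpleRoot i = β - simpleRoot i - simpleRoot j := sub_right_comm _ _ _
  have e3 : β - simpleRoot j + simpleRoot i = β + simpleRoot i - simpleRoot j := by abel
  have e4 : β + simpleRoot j - simpleRoot i = β - simpleRoot i + simpleRoot j := by abel
  rcases isPosRoot_cases hn hi1 hi hβ with ⟨hp, h'⟩ | ⟨hp, h'⟩ | ⟨hp, h'⟩ | ⟨hp, h'⟩ <;>
  rcases isPosRoot_cases hn hj1 hj hβ with ⟨hr, h''⟩ | ⟨hr, h''⟩ | ⟨hr, h''⟩ | ⟨hr, h''⟩ <;>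
  first
  | (subst h'; omega)
  | (subst h''; omega)
  | (subst h'; simp [tau_xvec, ip_add, aij, aji, aii, hβ, ai, aj])
  | (subst h''; simp [tau_xvec, ip_add, aij, aji, ajj, hβ, ai, aj])
  | (simp [tau_xvec, hp, hr, ip_add, ip_sub, aij, aji, hβ, h', h'', e1, e2, e3, e4, ai, aj, si, sj]
     try module)

lemma tau_braid (hn : 2 ≤ n) (hi1 : 1 ≤ i) (hi : i ≤ n) (hj1 : 1 ≤ j) (hj : j ≤ n)
    (h : Adj i j) :
    tau n q i * tau n q j * tau n q i = tau n q j * tau n q i * tau n q j := by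
  have aij := ip_simpleRoot_adj hi1 hi hj1 hj h
  have aji := aij
  rw [ip_simpleRoot_comm] at aji
  have aii := ip_simpleRoot_self hn hi1 hi
  have ajj := ip_simpleRoot_self hn hj1 hj
  have posi := isPosRoot_simpleRoot hn hi1 hi
  have posj := isPosRoot_simpleRoot hn hj1 hj
  have ai := fun β : ℕ → ℤ => IsPosRoot.add_simpleRoot hn hi1 hi (β := β)
  have aj := fun β : ℕ → ℤ => IsPosRoot.add_simpleRoot hn hj1 hj (β := β)
  have si := fun β : ℕ → ℤ => IsPosRoot.sub_simpleRoot hn hi1 hi (β := β)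
  have sj := fun β : ℕ → ℤ => IsPosRoot.sub_simpleRoot hn hj1 hj (β := β)
  refine Finsupp.lhom_ext' fun b => LinearMap.ext_ring ?_
  simp only [LinearMap.comp_apply, Finsupp.lsingle_apply, Module.End.mul_apply]
  rw [← xvec_root]
  generalize hb : root b = β
  have hβ : IsPosRoot n β := ⟨b, hb⟩
  clear hb b
  rcases isPosRoot_cases hn hi1 hi hβ with ⟨hp, h'⟩ | ⟨hp, h'⟩ | ⟨hp, h'⟩ | ⟨hp, h'⟩ <;>
  rcases isPosRoot_cases hn hj1 hj hβ with ⟨hr, h''⟩ | ⟨hr, h''⟩ | ⟨hr, h''⟩ | ⟨hr, h''⟩ <;>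
  first
  | (subst h'; omega)
  | (subst h''; omega)
  | (subst h'; simp [tau_xvec, ip_add, aij, aji, aii, ajj, hβ, posi, posj, ai, aj]; done)
  | (subst h''; simp [tau_xvec, ip_add, aij, aji, aii, ajj, hβ, posi, posj, ai, aj]; done)
  | (have := isPosRoot_cases hn hj1 hj h'
     simp [ip_add, ip_sub, aji, hr] at this; done)
  | (simp [tau_xvec, hp, hr, ip_add, ip_sub, aij, aji, aii, ajj, hβ, h', h'',
      ai, aj, si, sj]
     try module)
end braid

/-! ### The action of τ_k on labelled basis vectors -/

lemma tau_wbar_of_one (q : F) {k s t s' t' : ℕ} {h h' : Bool} (H : 1 ≤ s ∧ s < t ∧ t ≤ n)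
    (H' : 1 ≤ s' ∧ s' < t' ∧ t' ≤ n) (hp : ip n (simpleRoot k) (rootVec h s t) = 1)
    (e : rootVec h s t = rootVec h' s' t' + simpleRoot k) :
    tau n q k (wbar F n h s t) = q • wbar F n h' s' t' := by
  rw [← xvec_rootVec H, ← xvec_rootVec H', tau_xvec q k (isPosRoot_rootVec H), hp, e]
  simp

lemma tau_wbar_of_neg_one (q : F) {k s t s' t' : ℕ} {h h' : Bool} (H : 1 ≤ s ∧ s < t ∧ t ≤ n)
    (H' : 1 ≤ s' ∧ s' < t' ∧ t' ≤ n) (hp : ip n (simpleRoot k) (rootVec h s t) = -1)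
    (e : rootVec h' s' t' = rootVec h s t + simpleRoot k) :
    tau n q k (wbar F n h s t) = (1 - q ^ 2) • wbar F n h s t + q • wbar F n h' s' t' := by
  rw [← xvec_rootVec H, ← xvec_rootVec H', tau_xvec q k (isPosRoot_rootVec H), hp, e]
  simp

lemma tau_wbar_of_zero (q : F) {k s t : ℕ} {h : Bool} (H : 1 ≤ s ∧ s < t ∧ t ≤ n)
    (hp : ip n (simpleRoot k) (rootVec h s t) = 0) :
    tau n q k (wbar F n h s t) = wbar F n h s t := by
  rw [← xvec_rootVec H, tau_xvec q k (isPosRoot_rootVec H), hp]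
  simp

lemma tau_wbar_of_two (q : F) {k s t : ℕ} {h : Bool} (H : 1 ≤ s ∧ s < t ∧ t ≤ n)
    (hp : ip n (simpleRoot k) (rootVec h s t) = 2) :
    tau n q k (wbar F n h s t) = 0 := by
  rw [← xvec_rootVec H, tau_xvec q k (isPosRoot_rootVec H), hp]
  simp

section table
variable (q : F) {k s t : ℕ} {h : Bool}

lemma tau_w_fst_up (hk : k = s + 1) (hs : 1 ≤ s) (hst : s + 1 < t) (ht : t ≤ n) :
    tau n q k (wbar F n false s t) = q • wbar F n false (s + 1) t := by
  subst hk
  apply tau_wbar_of_one q (by omega) (by omega)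
  · rw [ip_rootVec (by omega) (by omega)]; split_ifs <;> simp at * <;> omega
  · simp [rootVec, simpleRoot, show s ≠ 0 by omega]

lemma tau_wh_fst_up (hk : k = s + 1) (hs : 1 ≤ s) (hst : s + 1 < t) (ht : t ≤ n) :
    tau n q k (wbar F n true s t) =
      (1 - q ^ 2) • wbar F n true s t + q • wbar F n true (s + 1) t := by
  subst hk
  apply tau_wbar_of_neg_one q (by omega) (by omega)
  · rw [ip_rootVec (by omega) (by omega)]; split_ifs <;> simp at * <;> omega
  · simp [rootVec, simpleRoot, show s ≠ 0 by omega]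

lemma tau_w_simple (hk : k = s + 1) (hs : 1 ≤ s) (hst : t = s + 1) (ht : t ≤ n) :
    tau n q k (wbar F n false s t) = 0 := by
  subst hk
  apply tau_wbar_of_two q (by omega)
  rw [ip_rootVec (by omega) (by omega)]; split_ifs <;> simp at * <;> omega

lemma tau_wh_adjacent (hk : k = s + 1) (hs : 1 ≤ s) (hst : t = s + 1) (ht : t ≤ n) :
    tau n q k (wbar F n true s t) = wbar F n true s t := by
  subst hk
  apply tau_wbar_of_zero q (by omega)
  rw [ip_rootVec (by omega) (by omega)]; split_ifs <;> simp at * <;> omega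

lemma tau_w_fst_down (hk : k = s) (hs : 2 ≤ s) (hst : s < t) (ht : t ≤ n) :
    tau n q k (wbar F n false s t) =
      (1 - q ^ 2) • wbar F n false s t + q • wbar F n false (s - 1) t := by
  subst hk
  apply tau_wbar_of_neg_one q (by omega) (by omega)
  · rw [ip_rootVec (by omega) (by omega)]; split_ifs <;> simp at * <;> omega
  · simp [rootVec, simpleRoot, show k ≠ 1 by omega]

lemma tau_wh_fst_down (hk : k = s) (hs : 2 ≤ s) (hst : s < t) (ht : t ≤ n) :
    tau n q k (wbar F n true s t) = q • wbar F n true (s - 1) t := by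
  subst hk
  apply tau_wbar_of_one q (by omega) (by omega)
  · rw [ip_rootVec (by omega) (by omega)]; split_ifs <;> simp at * <;> omega
  · simp [rootVec, simpleRoot, show k ≠ 1 by omega]

lemma tau_wbar_snd_down (hk : k = t) (hs : 1 ≤ s) (hst : s + 1 < t) (ht : t ≤ n) :
    tau n q k (wbar F n h s t) = q • wbar F n h s (t - 1) := by
  subst hk
  apply tau_wbar_of_one q (by omega) (by omega)
  · rw [ip_rootVec (by omega) (by omega)]; split_ifs <;> simp at * <;> omega
  · cases h <;> simp [rootVec, simpleRoot, show k ≠ 1 by omega] <;> abel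

lemma tau_wbar_snd_up (hk : k = t + 1) (hs : 1 ≤ s) (hst : s < t) (ht : t + 1 ≤ n) :
    tau n q k (wbar F n h s t) = (1 - q ^ 2) • wbar F n h s t + q • wbar F n h s (t + 1) := by
  subst hk
  apply tau_wbar_of_neg_one q (by omega) (by omega)
  · rw [ip_rootVec (by omega) (by omega)]; split_ifs <;> simp at * <;> omega
  · cases h <;> simp [rootVec, simpleRoot, show t ≠ 0 by omega] <;> abel

lemma tau_wbar_fixed (h2 : 2 ≤ k) (hk : k ≤ n) (hs : 1 ≤ s) (hst : s < t) (ht : t ≤ n)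
    (h3 : k ≠ s) (h4 : k ≠ s + 1) (h5 : k ≠ t) (h6 : k ≠ t + 1) :
    tau n q k (wbar F n h s t) = wbar F n h s t := by
  apply tau_wbar_of_zero q (by omega)
  rw [ip_rootVec h2 hk]; simp [h3, h4, h5, h6]

lemma tau_one_w_one (hk : k = 1) (hs : s = 1) (h3 : 3 ≤ t) (ht : t ≤ n) :
    tau n q k (wbar F n false s t) = (1 - q ^ 2) • wbar F n false s t + q • wbar F n true 2 t := by
  subst hk hs
  apply tau_wbar_of_neg_one q (by omega) (by omega)
  · rw [ip_rootVec_one (by omega) _ _ _ (by omega) (by omega), if_neg (by omega)]; rfl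
  · simp [rootVec, simpleRoot]

lemma tau_one_w_two (hk : k = 1) (hs : s = 2) (h3 : 3 ≤ t) (ht : t ≤ n) :
    tau n q k (wbar F n false s t) = (1 - q ^ 2) • wbar F n false s t + q • wbar F n true 1 t := by
  subst hk hs
  apply tau_wbar_of_neg_one q (by omega) (by omega)
  · rw [ip_rootVec_one (by omega) _ _ _ (by omega) (by omega), if_neg (by omega)]; rfl
  · simp [rootVec, simpleRoot]; abel

lemma tau_one_wh_one (hk : k = 1) (hs : s = 1) (h3 : 3 ≤ t) (ht : t ≤ n) :
    tau n q k (wbar F n true s t) = q • wbar F n false 2 t := by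
  subst hk hs
  apply tau_wbar_of_one q (by omega) (by omega)
  · rw [ip_rootVec_one (by omega) _ _ _ (by omega) (by omega), if_neg (by omega)]; rfl
  · simp [rootVec, simpleRoot]; abel

lemma tau_one_wh_two (hk : k = 1) (hs : s = 2) (h3 : 3 ≤ t) (ht : t ≤ n) :
    tau n q k (wbar F n true s t) = q • wbar F n false 1 t := by
  subst hk hs
  apply tau_wbar_of_one q (by omega) (by omega)
  · rw [ip_rootVec_one (by omega) _ _ _ (by omega) (by omega), if_neg (by omega)]; rfl
  · simp [rootVec, simpleRoot]

lemma tau_one_w_simple (hk : k = 1) (hs : s = 1) (h3 : t = 2) (ht : t ≤ n) :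
    tau n q k (wbar F n false s t) = wbar F n false s t := by
  subst hk hs h3
  apply tau_wbar_of_zero q (by omega)
  rw [ip_rootVec_one (by omega) _ _ _ (by omega) (by omega)]; rfl

lemma tau_one_wh_simple (hk : k = 1) (hs : s = 1) (h3 : t = 2) (ht : t ≤ n) :
    tau n q k (wbar F n true s t) = 0 := by
  subst hk hs h3
  apply tau_wbar_of_two q (by omega)
  rw [ip_rootVec_one (by omega) _ _ _ (by omega) (by omega)]; rfl

lemma tau_one_fixed (hk : k = 1) (hs : 3 ≤ s) (hst : s < t) (ht : t ≤ n) :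
    tau n q k (wbar F n h s t) = wbar F n h s t := by
  subst hk
  apply tau_wbar_of_zero q (by omega)
  rw [ip_rootVec_one (by omega) _ _ _ (by omega) (by omega), if_neg (by omega), if_neg (by omega)]
  rfl

end table

/-! ### The Cohen–Wales polynomials in closed form -/

/-- The Cohen-Wales polynomials as functions of the indices of a label. -/
def cwCoeff (q : F) (k : ℕ) (h : Bool) (s t : ℕ) : F :=
  let d := if h then s + t - 2 else t - s
  if h = false then
    if k ≤ s ∨ t < k then 0
    else if k = s + 1 ∧ k = t then q ^ 4
    else if k = s + 1 ∨ k = t then q ^ (d + 1) * (q ^ 2 - 1)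
    else q ^ (d - 1) * (q ^ 2 - 1) ^ 2
  else if k = 1 then
    if t = 2 then q ^ 4
    else if s ≤ 2 then q ^ (d + 1) * (q ^ 2 - 1)
    else q ^ (d - 3) * (q ^ 2 - 1) ^ 2 * (q ^ 2 + 1)
  else
    if t < k then 0
    else if k = s + 1 ∧ k = t then q ^ 2 * (q ^ 2 - 1) * (q ^ (2 * (k - 2)) - 1)
    else if k = s + 1 then q ^ (t - k) * (q ^ 2 - 1) ^ 2 * (q ^ (2 * (k - 2)) - 1)
    else if k = s ∨ k = t then q ^ (d + 1) * (q ^ 2 - 1)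
    else if k < s then q ^ (d - 3) * (q ^ 2 - 1) ^ 2 * (q ^ 2 + 1)
    else q ^ (d - 1) * (q ^ 2 - 1) ^ 2

lemma cwT_mkLabel (q : F) (k : ℕ) (h : Bool) (s t : ℕ) (H : 1 ≤ s ∧ s < t ∧ t ≤ n) :
    cwT q k (mkLabel h s t H) = cwCoeff q k h s t := rfl

/-- The linear form `x_β ↦ T_{k,β}`. -/
def cwForm (n : ℕ) (q : F) (k : ℕ) : V F n →ₗ[F] F :=
  Finsupp.linearCombination F fun b : Label n => cwT q k b

lemma cwForm_wbar (q : F) (k : ℕ) {h : Bool} {s t : ℕ} (h1 : 1 ≤ s) (h2 : s < t) (h3 : t ≤ n) :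
    cwForm n q k (wbar F n h s t) = cwCoeff q k h s t := by
  rw [wbar_eq_single ⟨h1, h2, h3⟩, ← cwT_mkLabel q k h s t ⟨h1, h2, h3⟩]
  simp [cwForm]

section coeff
variable {q : F} {k s t : ℕ}

lemma cwCoeff_w_zero_left (h : k ≤ s) : cwCoeff q k false s t = 0 := by
  simp [cwCoeff, h]

lemma cwCoeff_w_zero_right (h : t < k) : cwCoeff q k false s t = 0 := by
  simp [cwCoeff, h]

lemma cwCoeff_w_simple (hk : k = s + 1) (ht : t = s + 1) : cwCoeff q k false s t = q ^ 4 := by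
  simp [cwCoeff, hk, ht]

/-- Here and below, exponents are split into quotients of powers of q. This removes truncated
subtraction, so that values at shifted indices can be compared by `field_simp` and `ring1`. -/
lemma cwCoeff_w_fst (hq : q ≠ 0) (hk : k = s + 1) (hst : s + 1 < t) :
    cwCoeff q k false s t = q * q ^ t / q ^ s * (q ^ 2 - 1) := by
  have e : q ^ (t - s + 1) = q * q ^ t / q ^ s := by
    rw [eq_div_iff (pow_ne_zero _ hq), ← pow_add, ← pow_succ']; congr 1; omega
  simp [cwCoeff, hk, show ¬ t < s + 1 by omega, show ¬ s + 1 = t by omega, e]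

lemma cwCoeff_w_snd (hq : q ≠ 0) (hk : k = t) (hst : s + 1 < t) :
    cwCoeff q k false s t = q * q ^ t / q ^ s * (q ^ 2 - 1) := by
  have e : q ^ (t - s + 1) = q * q ^ t / q ^ s := by
    rw [eq_div_iff (pow_ne_zero _ hq), ← pow_add, ← pow_succ']; congr 1; omega
  simp [cwCoeff, hk, show ¬ t ≤ s by omega, show ¬ t = s + 1 by omega, e]

lemma cwCoeff_w_mid (hq : q ≠ 0) (hk : s + 1 < k) (hst : k < t) :
    cwCoeff q k false s t = q ^ t / q ^ s / q * (q ^ 2 - 1) ^ 2 := by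
  have e : q ^ (t - s - 1) = q ^ t / q ^ s / q := by
    rw [eq_div_iff hq, eq_div_iff (pow_ne_zero _ hq), ← pow_succ, ← pow_add]; congr 1; omega
  simp [cwCoeff, show ¬ (k ≤ s ∨ t < k) by omega, show ¬ (k = s + 1 ∧ k = t) by omega,
    show ¬ (k = s + 1 ∨ k = t) by omega, e]

lemma cwCoeff_wh_simple (hk : k = 1) (ht : t = 2) : cwCoeff q k true s t = q ^ 4 := by
  simp [cwCoeff, hk, ht]

lemma cwCoeff_wh_one (hq : q ≠ 0) (hk : k = 1) (hs : 1 ≤ s) (hs' : s ≤ 2) (ht : 2 < t) :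
    cwCoeff q k true s t = q ^ s * q ^ t / q * (q ^ 2 - 1) := by
  have e : q ^ (s + t - 2 + 1) = q ^ s * q ^ t / q := by
    rw [eq_div_iff hq, ← pow_succ, ← pow_add]; congr 1; omega
  simp [cwCoeff, hk, show ¬ t = 2 by omega, hs', e]

lemma cwCoeff_wh_one_far (hq : q ≠ 0) (hk : k = 1) (hs : 3 ≤ s) (ht : s < t) :
    cwCoeff q k true s t = q ^ s * q ^ t / q ^ 5 * (q ^ 2 - 1) ^ 2 * (q ^ 2 + 1) := by
  have e : q ^ (s + t - 2 - 3) = q ^ s * q ^ t / q ^ 5 := by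
    rw [eq_div_iff (pow_ne_zero _ hq), ← pow_add, ← pow_add]; congr 1; omega
  simp [cwCoeff, hk, show ¬ t = 2 by omega, show ¬ s ≤ 2 by omega, e]

lemma cwCoeff_wh_zero (h2 : 2 ≤ k) (h : t < k) : cwCoeff q k true s t = 0 := by
  simp [cwCoeff, h, show k ≠ 1 by omega]

/-- For k = 2 the value is 0: the root is then α_1, and `cwForm_simple_ne` relies on this. -/
lemma cwCoeff_wh_adjacent (hq : q ≠ 0) (h2 : 2 ≤ k) (hk : k = s + 1) (ht : t = s + 1) :
    cwCoeff q k true s t = (q ^ 2 - 1) * (q ^ k * q ^ k / q ^ 2 - q ^ 2) := by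
  obtain ⟨c, rfl⟩ := Nat.exists_eq_add_of_le h2
  simp [cwCoeff, hk.symm, ht.trans hk.symm, show 2 + c ≠ 1 by omega]
  field_simp
  ring

lemma cwCoeff_wh_fst (hq : q ≠ 0) (h2 : 2 ≤ k) (hk : k = s + 1) (ht : s + 1 < t) :
    cwCoeff q k true s t = (q ^ 2 - 1) ^ 2 * (q ^ t * q ^ k / q ^ 4 - q ^ t / q ^ k) := by
  subst hk
  obtain ⟨c, rfl⟩ := Nat.exists_eq_add_of_lt ht
  obtain ⟨s, rfl⟩ : ∃ a, s = a + 1 := ⟨s - 1, by omega⟩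
  have e : s + 1 + 1 + c + 1 - (s + 1 + 1) = c + 1 := by omega
  simp [cwCoeff, e, show ¬ s + 1 + 1 + c + 1 < s + 1 + 1 by omega,
    show ¬ s + 1 = s + 1 + 1 + c by omega]
  field_simp
  ring

lemma cwCoeff_wh_fst_eq (hq : q ≠ 0) (h2 : 2 ≤ k) (hk : k = s) (ht : s < t) :
    cwCoeff q k true s t = q ^ s * q ^ t / q * (q ^ 2 - 1) := by
  have e : q ^ (s + t - 2 + 1) = q ^ s * q ^ t / q := by
    rw [eq_div_iff hq, ← pow_succ, ← pow_add]; congr 1; omega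
  simp [cwCoeff, hk, show ¬ s = 1 by omega, show ¬ t < s by omega, e]

lemma cwCoeff_wh_snd_eq (hq : q ≠ 0) (h2 : 2 ≤ k) (hk : k = t) (ht : s + 1 < t) :
    cwCoeff q k true s t = q ^ s * q ^ t / q * (q ^ 2 - 1) := by
  have e : q ^ (s + t - 2 + 1) = q ^ s * q ^ t / q := by
    rw [eq_div_iff hq, ← pow_succ, ← pow_add]; congr 1; omega
  simp [cwCoeff, hk, show ¬ t = 1 by omega, show ¬ t = s + 1 by omega, e]

lemma cwCoeff_wh_far (hq : q ≠ 0) (h2 : 2 ≤ k) (hk : k < s) (ht : s < t) :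
    cwCoeff q k true s t = q ^ s * q ^ t / q ^ 5 * (q ^ 2 - 1) ^ 2 * (q ^ 2 + 1) := by
  have e : q ^ (s + t - 2 - 3) = q ^ s * q ^ t / q ^ 5 := by
    rw [eq_div_iff (pow_ne_zero _ hq), ← pow_add, ← pow_add]; congr 1; omega
  simp only [cwCoeff]
  rw [if_neg (by simp), if_neg (by omega), if_neg (by omega), if_neg (by omega), if_neg (by omega),
    if_neg (by omega), if_pos (by omega)]
  simp [e]

lemma cwCoeff_wh_mid (hq : q ≠ 0) (hs : 1 ≤ s) (hk : s + 1 < k) (ht : k < t) :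
    cwCoeff q k true s t = q ^ s * q ^ t / q ^ 3 * (q ^ 2 - 1) ^ 2 := by
  have e : q ^ (s + t - 2 - 1) = q ^ s * q ^ t / q ^ 3 := by
    rw [eq_div_iff (pow_ne_zero _ hq), ← pow_add, ← pow_add]; congr 1; omega
  simp only [cwCoeff]
  rw [if_neg (by simp), if_neg (by omega), if_neg (by omega), if_neg (by omega), if_neg (by omega),
    if_neg (by omega), if_neg (by omega)]
  simp [e]

end coeff

/-! ### Compatibility of the forms T_k with the operators τ_k -/

lemma linearMap_ext_wbar {M : Type*} [AddCommMonoid M] [Module F M] {f g : V F n →ₗ[F] M}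
    (H : ∀ h s t, 1 ≤ s → s < t → t ≤ n → f (wbar F n h s t) = g (wbar F n h s t)) : f = g := by
  refine Finsupp.lhom_ext' fun b => LinearMap.ext_ring ?_
  obtain ⟨h, s, t, hb, rfl⟩ := exists_mkLabel b
  simpa [wbar_eq_single hb] using H h s t hb.1 hb.2.1 hb.2.2

/-- The coefficient of x_{α_i+α_j} in the t-linear part of the braid relation demands this symmetry.
The two operators involve only the coordinates a, a + 1, a + 2, so five positions for each of s and
t exhaust the cases. -/
lemma cwForm_tau_adj_path {q : F} (hq : q ≠ 0) {a : ℕ} (ha : 1 ≤ a) (han : a + 2 ≤ n) :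
    cwForm n q (a + 2) ∘ₗ tau n q (a + 1) = cwForm n q (a + 1) ∘ₗ tau n q (a + 2) := by
  refine linearMap_ext_wbar fun h s t hs hst ht => ?_
  simp only [LinearMap.comp_apply]
  have hs' : s < a ∨ s = a ∨ s = a + 1 ∨ s = a + 2 ∨ a + 2 < s := by omega
  have ht' : t < a ∨ t = a ∨ t = a + 1 ∨ t = a + 2 ∨ a + 2 < t := by omega
  rcases hs' with hs' | rfl | rfl | rfl | hs' <;> rcases ht' with ht' | rfl | rfl | rfl | ht' <;>
  first
  | omega
  | (cases h <;>
     simp (disch := omega) only [tau_w_fst_up, tau_wh_fst_up, tau_w_simple, tau_wh_adjacent,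
      tau_w_fst_down, tau_wh_fst_down, tau_wbar_snd_down, tau_wbar_snd_up, tau_wbar_fixed,
      map_add, map_smul, map_zero, smul_eq_mul, cwForm_wbar, Nat.add_sub_cancel, Nat.add_succ_sub_one,
      cwCoeff_w_zero_left, cwCoeff_w_zero_right, cwCoeff_w_simple, cwCoeff_w_fst hq,
      cwCoeff_w_snd hq, cwCoeff_w_mid hq, cwCoeff_wh_zero, cwCoeff_wh_adjacent hq,
      cwCoeff_wh_fst hq, cwCoeff_wh_fst_eq hq, cwCoeff_wh_snd_eq hq, cwCoeff_wh_far hq,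
      cwCoeff_wh_mid hq, pow_add] <;> try (field_simp; try ring1))

lemma cwForm_tau_adj_one_three {q : F} (hq : q ≠ 0) (hn : 3 ≤ n) :
    cwForm n q 3 ∘ₗ tau n q 1 = cwForm n q 1 ∘ₗ tau n q 3 := by
  refine linearMap_ext_wbar fun h s t hs hst ht => ?_
  simp only [LinearMap.comp_apply]
  have hs' : s = 1 ∨ s = 2 ∨ s = 3 ∨ 3 < s := by omega
  have ht' : t = 2 ∨ t = 3 ∨ 3 < t := by omega
  rcases hs' with rfl | rfl | rfl | hs' <;> rcases ht' with rfl | rfl | ht' <;>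
  first
  | omega
  | (cases h <;>
     simp (disch := omega) only [tau_w_fst_up, tau_wh_fst_up, tau_w_simple, tau_wh_adjacent,
      tau_w_fst_down, tau_wh_fst_down, tau_wbar_snd_down, tau_wbar_snd_up, tau_wbar_fixed,
      tau_one_w_one, tau_one_w_two, tau_one_wh_one, tau_one_wh_two, tau_one_w_simple,
      tau_one_wh_simple, tau_one_fixed,
      map_add, map_smul, map_zero, smul_eq_mul, cwForm_wbar, Nat.add_sub_cancel, Nat.add_succ_sub_one,
      cwCoeff_w_zero_left, cwCoeff_w_zero_right, cwCoeff_w_simple, cwCoeff_w_fst hq,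
      cwCoeff_w_snd hq, cwCoeff_w_mid hq, cwCoeff_wh_zero, cwCoeff_wh_adjacent hq,
      cwCoeff_wh_fst hq, cwCoeff_wh_fst_eq hq, cwCoeff_wh_snd_eq hq, cwCoeff_wh_far hq,
      cwCoeff_wh_mid hq, cwCoeff_wh_simple, cwCoeff_wh_one hq, cwCoeff_wh_one_far hq, pow_add] <;>
      try (field_simp; try ring1))

lemma cwForm_one_tau {q : F} (hq : q ≠ 0) {j : ℕ} (hj1 : 2 ≤ j) (hj : j ≤ n) (hj3 : j ≠ 3) :
    cwForm n q 1 ∘ₗ tau n q j = cwForm n q 1 := by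
  refine linearMap_ext_wbar fun h s t hs hst ht => ?_
  simp only [LinearMap.comp_apply]
  obtain ⟨a, rfl⟩ : ∃ a, j = a + 1 := ⟨j - 1, by omega⟩
  -- The value a = 2 would be the node 3, the only neighbour of 1.
  have ha : a = 1 ∨ 3 ≤ a := by omega
  have hs2 : s ≤ 2 ∨ 3 ≤ s := by omega
  have hst' : (s = a ∧ t = a + 1) ∨ (s = a ∧ a + 1 < t) ∨ s = a + 1 ∨ (t = a + 1 ∧ s < a) ∨
    t = a ∨ (s ≠ a ∧ s ≠ a + 1 ∧ t ≠ a + 1 ∧ t ≠ a) := by omega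
  rcases hst' with ⟨rfl, rfl⟩ | ⟨rfl, h3⟩ | rfl | ⟨rfl, h3⟩ | rfl | ⟨h3, h4, h5, h6⟩
  on_goal 6 => rw [tau_wbar_fixed] <;> omega
  all_goals
  rcases ha with ha | ha <;> rcases hs2 with hs2 | hs2 <;>
  first
  | omega
  | (cases h <;>
      simp (disch := omega) only [tau_w_fst_up, tau_wh_fst_up, tau_w_simple, tau_wh_adjacent,
        tau_w_fst_down, tau_wh_fst_down, tau_wbar_snd_down, tau_wbar_snd_up,
        map_add, map_smul, map_zero, smul_eq_mul, cwForm_wbar, Nat.add_sub_cancel,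
        Nat.add_succ_sub_one, cwCoeff_w_zero_left, cwCoeff_wh_simple, cwCoeff_wh_one hq,
        cwCoeff_wh_one_far hq, pow_add] <;> try (field_simp; try ring1))

lemma cwForm_tau_not_adj {q : F} (hq : q ≠ 0) {i j : ℕ} (hi1 : 1 ≤ i) (hi : i ≤ n) (hj1 : 1 ≤ j)
    (hj : j ≤ n) (hne : i ≠ j) (hij : ¬ Adj i j) :
    cwForm n q i ∘ₗ tau n q j = cwForm n q i := by
  refine linearMap_ext_wbar fun h s t hs hst ht => ?_
  unfold Adj at hij
  simp only [LinearMap.comp_apply]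
  have hi' : i = 1 ∨ (2 ≤ i ∧ (i < s ∨ i = s ∨ i = s + 1 ∨ (s + 1 < i ∧ i < t) ∨
    (i = t ∧ s + 1 < t) ∨ t < i)) := by omega
  obtain rfl | hj2 : j = 1 ∨ 2 ≤ j := by omega
  · have hst' : (s = 1 ∧ t = 2) ∨ (s = 1 ∧ 3 ≤ t) ∨ s = 2 ∨ 3 ≤ s := by omega
    rcases hst' with ⟨rfl, rfl⟩ | ⟨rfl, h3⟩ | rfl | h3 <;>
    rcases hi' with h1 | ⟨h2, h1 | h1 | h1 | ⟨h1, h1'⟩ | ⟨h1, h1'⟩ | h1⟩ <;>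
    first
    | omega
    | (try subst h1
       cases h <;>
       simp (disch := omega) only [
        tau_one_w_one, tau_one_w_two, tau_one_wh_one, tau_one_wh_two, tau_one_w_simple,
        tau_one_wh_simple, tau_one_fixed,
        map_add, map_smul, map_zero, smul_eq_mul, cwForm_wbar, Nat.add_sub_cancel, Nat.add_succ_sub_one,
        cwCoeff_w_zero_left, cwCoeff_w_zero_right, cwCoeff_w_simple, cwCoeff_w_fst hq,
        cwCoeff_w_snd hq, cwCoeff_w_mid hq, cwCoeff_wh_zero, cwCoeff_wh_adjacent hq,
        cwCoeff_wh_fst hq, cwCoeff_wh_fst_eq hq, cwCoeff_wh_snd_eq hq, cwCoeff_wh_far hq,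
        cwCoeff_wh_mid hq, cwCoeff_wh_simple, cwCoeff_wh_one hq, cwCoeff_wh_one_far hq, pow_add] <;>
        try (field_simp; try ring1))
  · obtain ⟨a, rfl⟩ : ∃ a, j = a + 1 := ⟨j - 1, by omega⟩
    have hst' : (s = a ∧ t = a + 1) ∨ (s = a ∧ a + 1 < t) ∨ s = a + 1 ∨ (t = a + 1 ∧ s < a) ∨
      t = a ∨ (s ≠ a ∧ s ≠ a + 1 ∧ t ≠ a + 1 ∧ t ≠ a) := by omega
    rcases hi' with rfl | ⟨h2, hi'⟩
    · exact DFunLike.congr_fun (cwForm_one_tau hq hj2 hj (by omega)) _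
    rcases hst' with ⟨rfl, rfl⟩ | ⟨rfl, h3⟩ | rfl | ⟨rfl, h3⟩ | rfl | ⟨h3, h4, h5, h6⟩
    on_goal 6 => rw [tau_wbar_fixed] <;> omega
    all_goals
    rcases hi' with h1 | h1 | h1 | ⟨h1, h1'⟩ | ⟨h1, h1'⟩ | h1 <;>
    first
    | omega
    | (cases h <;>
       simp (disch := omega) only [tau_w_fst_up, tau_wh_fst_up, tau_w_simple, tau_wh_adjacent,
        tau_w_fst_down, tau_wh_fst_down, tau_wbar_snd_down, tau_wbar_snd_up, tau_wbar_fixed,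
        map_add, map_smul, map_zero, smul_eq_mul, cwForm_wbar, Nat.add_sub_cancel,
        Nat.add_succ_sub_one, cwCoeff_w_zero_left, cwCoeff_w_zero_right, cwCoeff_w_simple,
        cwCoeff_w_fst hq, cwCoeff_w_snd hq, cwCoeff_w_mid hq, cwCoeff_wh_zero,
        cwCoeff_wh_adjacent hq, cwCoeff_wh_fst hq, cwCoeff_wh_fst_eq hq, cwCoeff_wh_snd_eq hq,
        cwCoeff_wh_far hq, cwCoeff_wh_mid hq, cwCoeff_wh_simple, pow_add] <;>
        try (field_simp; try ring1))

/-! ### Abstract CGW modules with rank one e_k -/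

/-- A module with operators `g_k`, vectors `x_k` and linear forms `φ_k` for the nodes `k` of `D_n`,
such that the `g_k` and the rank one operators `e_k = (l / m) x_k ⊗ φ_k` satisfy the relations of
the CGW algebra. -/
structure CGWModule (n : ℕ) (l r : F) (E : Type*) [AddCommGroup E] [Module F E] where
  g : ℕ → Module.End F E
  x : ℕ → E
  φ : ℕ → E →ₗ[F] F
  x_ne {k : ℕ} (hk : 1 ≤ k ∧ k ≤ n) : x k ≠ 0
  comm {i j : ℕ} (hi : 1 ≤ i ∧ i ≤ n) (hj : 1 ≤ j ∧ j ≤ n) (h : ¬ Adj i j) (v : E) :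
    g i (g j v) = g j (g i v)
  braid {i j : ℕ} (hi : 1 ≤ i ∧ i ≤ n) (hj : 1 ≤ j ∧ j ≤ n) (h : Adj i j) (v : E) :
    g i (g j (g i v)) = g j (g i (g j v))
  quad {k : ℕ} (hk : 1 ≤ k ∧ k ≤ n) (v : E) : g k (g k v) = v - mPar r • g k v + φ k v • x k
  g_x_self {k : ℕ} (hk : 1 ≤ k ∧ k ≤ n) : g k (x k) = l⁻¹ • x k
  g_x {i j : ℕ} (hi : 1 ≤ i ∧ i ≤ n) (hj : 1 ≤ j ∧ j ≤ n) (hne : i ≠ j) (h : ¬ Adj i j) :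
    g i (x j) = r • x j
  -- With `quad` and `g_g_x` this forces φ_i(g_j x_i) = m, that is, e_i g_j e_i = l e_i; see
  -- `φ_g_x`.
  g_x_adj {i j : ℕ} (hi : 1 ≤ i ∧ i ≤ n) (hj : 1 ≤ j ∧ j ≤ n) (h : Adj i j) :
    g i (x j) + mPar r • x j = g j (x i) + mPar r • x i
  g_g_x {i j : ℕ} (hi : 1 ≤ i ∧ i ≤ n) (hj : 1 ≤ j ∧ j ≤ n) (h : Adj i j) :
    g i (g j (x i)) = x j
  φ_x_adj {i j : ℕ} (hi : 1 ≤ i ∧ i ≤ n) (hj : 1 ≤ j ∧ j ≤ n) (h : Adj i j) :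
    φ i (x j) = mPar r / l

lemma Adj.symm {i j : ℕ} (h : Adj i j) : Adj j i := by unfold Adj at *; omega

/-! ### Values on simple roots and the quadratic relation for τ_k -/

section forms

lemma cwForm_simple_self (q : F) {k : ℕ} (hn : 2 ≤ n) (hk : 1 ≤ k ∧ k ≤ n) :
    cwForm n q k (xvec F n (simpleRoot k)) = q ^ 4 := by
  obtain rfl | h2 : k = 1 ∨ 2 ≤ k := by omega
  · rw [simpleRoot_one, xvec_rootVec (by omega), cwForm_wbar q 1 le_rfl one_lt_two hn,
      cwCoeff_wh_simple rfl rfl]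
  · rw [simpleRoot_eq h2, xvec_rootVec (by omega), cwForm_wbar q k (by omega) (by omega) (by omega),
      cwCoeff_w_simple (by omega) (by omega)]

lemma cwForm_simple_ne {q : F} (hq : q ≠ 0) {i j : ℕ} (hn : 2 ≤ n) (hi : 1 ≤ i ∧ i ≤ n)
    (hj : 1 ≤ j ∧ j ≤ n) (hne : i ≠ j) : cwForm n q i (xvec F n (simpleRoot j)) = 0 := by
  obtain rfl | h2 : j = 1 ∨ 2 ≤ j := by omega
  · rw [simpleRoot_one, xvec_rootVec (by omega), cwForm_wbar q i le_rfl one_lt_two hn]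
    obtain rfl | h3 : i = 2 ∨ 2 < i := by omega
    · rw [cwCoeff_wh_adjacent (s := 1) (t := 2) hq le_rfl rfl rfl]
      field_simp
      simp
    · rw [cwCoeff_wh_zero h3.le h3]
  · rw [simpleRoot_eq h2, xvec_rootVec (by omega), cwForm_wbar q i (by omega) (by omega) (by omega)]
    obtain h3 | h3 : i ≤ j - 1 ∨ j < i := by omega
    · rw [cwCoeff_w_zero_left h3]
    · rw [cwCoeff_w_zero_right h3]

lemma cwForm_tau_adj {q : F} (hq : q ≠ 0) {i j : ℕ} (hi : 1 ≤ i ∧ i ≤ n) (hj : 1 ≤ j ∧ j ≤ n)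
    (h : Adj i j) (v : V F n) : cwForm n q j (tau n q i v) = cwForm n q i (tau n q j v) := by
  wlog hij : i < j generalizing i j
  · exact (this hj hi h.symm (by unfold Adj at h; omega)).symm
  unfold Adj at h
  obtain ⟨rfl, rfl⟩ | h2 : (i = 1 ∧ j = 3) ∨ 2 ≤ i := by omega
  · exact DFunLike.congr_fun (cwForm_tau_adj_one_three hq hj.2) v
  · obtain ⟨a, rfl⟩ : ∃ a, i = a + 1 := ⟨i - 1, by omega⟩
    obtain rfl : j = a + 2 := by omega
    exact DFunLike.congr_fun (cwForm_tau_adj_path hq (by omega) hj.2) v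

lemma cwForm_tau_nadj {q : F} (hq : q ≠ 0) {i j : ℕ} (hi : 1 ≤ i ∧ i ≤ n) (hj : 1 ≤ j ∧ j ≤ n)
    (hne : i ≠ j) (h : ¬ Adj i j) (v : V F n) : cwForm n q i (tau n q j v) = cwForm n q i v :=
  DFunLike.congr_fun (cwForm_tau_not_adj hq hi.1 hi.2 hj.1 hj.2 hne h) v

open scoped Classical in
/-- The coordinate along `x_{α_k}`. -/
def simpleCoord (F : Type) [Field F] (n k : ℕ) : V F n →ₗ[F] F :=
  Finsupp.linearCombination F fun b : Label n => if root b = simpleRoot k then 1 else 0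

lemma tau_simple_self (q : F) {k : ℕ} (hn : 2 ≤ n) (hk : 1 ≤ k ∧ k ≤ n) :
    tau n q k (xvec F n (simpleRoot k)) = 0 := by
  rw [tau_xvec q k (isPosRoot_simpleRoot hn hk.1 hk.2), ip_simpleRoot_self hn hk.1 hk.2, if_pos rfl]

lemma tau_simple_adj (q : F) {i j : ℕ} (hn : 2 ≤ n) (hi : 1 ≤ i ∧ i ≤ n) (hj : 1 ≤ j ∧ j ≤ n)
    (h : Adj i j) : tau n q i (xvec F n (simpleRoot j)) =
      (1 - q ^ 2) • xvec F n (simpleRoot j) + q • xvec F n (simpleRoot j + simpleRoot i) := by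
  rw [tau_xvec q i (isPosRoot_simpleRoot hn hj.1 hj.2), ip_simpleRoot_adj hi.1 hi.2 hj.1 hj.2 h]
  simp

lemma tau_simple_nadj (q : F) {i j : ℕ} (hn : 2 ≤ n) (hi : 1 ≤ i ∧ i ≤ n) (hj : 1 ≤ j ∧ j ≤ n)
    (hne : i ≠ j) (h : ¬ Adj i j) :
    tau n q i (xvec F n (simpleRoot j)) = xvec F n (simpleRoot j) := by
  rw [tau_xvec q i (isPosRoot_simpleRoot hn hj.1 hj.2),
    ip_simpleRoot_not_adj hi.1 hi.2 hj.1 hj.2 hne h]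
  simp

lemma tau_simple_add (q : F) {i j : ℕ} (hn : 2 ≤ n) (hi : 1 ≤ i ∧ i ≤ n) (hj : 1 ≤ j ∧ j ≤ n)
    (h : Adj i j) : tau n q i (xvec F n (simpleRoot j + simpleRoot i)) =
      q • xvec F n (simpleRoot j) := by
  have h1 := ip_simpleRoot_adj hi.1 hi.2 hj.1 hj.2 h
  rw [tau_xvec q i ((isPosRoot_simpleRoot hn hj.1 hj.2).add_simpleRoot hn hi.1 hi.2 h1), ip_add, h1,
    ip_simpleRoot_self hn hi.1 hi.2]
  simp

open scoped Classical in
-- Away from x_{α_k} the operator satisfies the Hecke relation (τ - 1)(τ + q²) = 0. Since τ_k kills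
-- x_{α_k}, that relation fails there by a rank one term.
lemma tau_tau (q : F) {k : ℕ} (hn : 2 ≤ n) (hk : 1 ≤ k ∧ k ≤ n) (v : V F n) :
    tau n q k (tau n q k v) = (1 - q ^ 2) • tau n q k v + q ^ 2 • v
      - (q ^ 2 * simpleCoord F n k v) • xvec F n (simpleRoot k) := by
  suffices H : tau n q k ∘ₗ tau n q k = (1 - q ^ 2) • tau n q k + q ^ 2 • LinearMap.id
      - (q ^ 2 • simpleCoord F n k).smulRight (xvec F n (simpleRoot k)) from DFunLike.congr_fun H v
  refine Finsupp.lhom_ext' fun b => LinearMap.ext_ring ?_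
  have hc : simpleCoord F n k (Finsupp.single b 1) = if root b = simpleRoot k then 1 else 0 := by
    simp [simpleCoord]
  simp only [LinearMap.comp_apply, Finsupp.lsingle_apply, LinearMap.sub_apply, LinearMap.add_apply,
    LinearMap.smul_apply, LinearMap.smulRight_apply, hc, LinearMap.id_apply]
  rw [← xvec_root]
  generalize hb : root b = β
  have hβ : IsPosRoot n β := ⟨b, hb⟩
  clear hc hb b
  have hkk := ip_simpleRoot_self hn hk.1 hk.2
  rcases isPosRoot_cases hn hk.1 hk.2 hβ with ⟨hp, rfl⟩ | ⟨hp, h'⟩ | ⟨hp, h'⟩ | ⟨hp, h'⟩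
  · simp [tau_simple_self q hn hk]
  all_goals
    have hne : β ≠ simpleRoot k := by rintro rfl; omega
    simp [tau_xvec, hp, h', hβ, ip_add, ip_sub, hkk, hne]
    try module

end forms

/-! ### Artin relations for the operators σ_k -/

/-- The Cohen-Wales operators for an arbitrary `k`. -/
def sigma (n : ℕ) (t q : F) (k : ℕ) : Module.End F (V F n) :=
  tau n q k + (t • cwForm n q k).smulRight (xvec F n (simpleRoot k))

lemma sigma_apply (t q : F) (k : ℕ) (v : V F n) :
    sigma n t q k v = tau n q k v + (t * cwForm n q k v) • xvec F n (simpleRoot k) := rfl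

lemma cw_eq_sigma (t q : F) (k : Node n) : cw n t q k = sigma n t q k.1 := by
  refine Finsupp.lhom_ext' fun b => LinearMap.ext_ring ?_
  simp [cw, sigma, cwTau, tau, cwForm]

section sigma

variable {q : F} (t : F)

lemma sigma_comm (hq : q ≠ 0) {i j : ℕ} (hn : 2 ≤ n) (hi : 1 ≤ i ∧ i ≤ n) (hj : 1 ≤ j ∧ j ≤ n)
    (h : ¬ Adj i j) (v : V F n) :
    sigma n t q i (sigma n t q j v) = sigma n t q j (sigma n t q i v) := by
  obtain rfl | hne := eq_or_ne i j
  · rfl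
  have h' : ¬ Adj j i := fun h1 => h h1.symm
  have e : tau n q i (tau n q j v) = tau n q j (tau n q i v) :=
    DFunLike.congr_fun (tau_comm q hn hi.1 hi.2 hj.1 hj.2 hne h) v
  simp only [sigma_apply, map_add, map_smul, smul_eq_mul, cwForm_simple_ne hq hn hi hj hne,
    cwForm_simple_ne hq hn hj hi hne.symm, cwForm_tau_nadj hq hi hj hne h,
    cwForm_tau_nadj hq hj hi hne.symm h', tau_simple_nadj q hn hi hj hne h,
    tau_simple_nadj q hn hj hi hne.symm h', e]
  module

/-- The pure τ part is the braid relation for τ. In the rest, the symmetry of the forms reduces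
every coefficient to a combination of T_i(v), T_j(v) and T_i(τ_j v). -/
lemma sigma_braid (hq : q ≠ 0) {i j : ℕ} (hn : 2 ≤ n) (hi : 1 ≤ i ∧ i ≤ n) (hj : 1 ≤ j ∧ j ≤ n)
    (h : Adj i j) (v : V F n) :
    sigma n t q i (sigma n t q j (sigma n t q i v)) =
      sigma n t q j (sigma n t q i (sigma n t q j v)) := by
  have hne : i ≠ j := by rintro rfl; unfold Adj at h; omega
  have e : tau n q i (tau n q j (tau n q i v)) = tau n q j (tau n q i (tau n q j v)) :=
    DFunLike.congr_fun (tau_braid q hn hi.1 hi.2 hj.1 hj.2 h) v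
  have ha := fun w => cwForm_tau_adj (n := n) hq hi hj h w
  have hij : cwForm n q i (xvec F n (simpleRoot j)) = 0 := cwForm_simple_ne hq hn hi hj hne
  have hji : cwForm n q j (xvec F n (simpleRoot i)) = 0 := cwForm_simple_ne hq hn hj hi hne.symm
  have hii := cwForm_simple_self (n := n) q hn hi
  have hjj := cwForm_simple_self (n := n) q hn hj
  have ti := tau_simple_self (n := n) q hn hi
  have tj := tau_simple_self (n := n) q hn hj
  have tij := tau_simple_adj q hn hi hj h
  have tji := tau_simple_adj q hn hj hi h.symm
  have sij := tau_simple_add q hn hi hj h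
  have sji := tau_simple_add q hn hj hi h.symm
  rw [add_comm (simpleRoot i)] at tji sji
  -- The symmetry evaluated at x_{α_i}, which τ_i kills, gives this value without the explicit
  -- polynomial.
  have e1 : cwForm n q i (xvec F n (simpleRoot j + simpleRoot i)) = q ^ 3 * (q ^ 2 - 1) := by
    have := ha (xvec F n (simpleRoot i))
    rw [ti, tji] at this
    simp only [map_add, map_smul, map_zero, smul_eq_mul, hii] at this
    refine mul_left_cancel₀ hq ?_
    linear_combination -this
  have e2 : cwForm n q j (xvec F n (simpleRoot j + simpleRoot i)) = q ^ 3 * (q ^ 2 - 1) := by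
    have := ha (xvec F n (simpleRoot j))
    rw [tj, tij] at this
    simp only [map_add, map_smul, map_zero, smul_eq_mul, hjj] at this
    refine mul_left_cancel₀ hq ?_
    linear_combination this
  -- The symmetry turns T_i τ_j τ_i into T_j τ_i². The rank one term of `tau_tau` drops out because
  -- T_j(x_{α_i}) = 0.
  have f1 : cwForm n q i (tau n q j (tau n q i v)) =
      (1 - q ^ 2) * cwForm n q j (tau n q i v) + q ^ 2 * cwForm n q j v := by
    rw [← ha, tau_tau q hn hi]
    simp [hji]
  have f2 : cwForm n q j (tau n q i (tau n q j v)) =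
      (1 - q ^ 2) * cwForm n q i (tau n q j v) + q ^ 2 * cwForm n q i v := by
    rw [ha, tau_tau q hn hj]
    simp [hij]
  have f3 := ha v
  simp only [sigma_apply, map_add, map_smul, smul_eq_mul, hij, hji, hii, hjj, ti, tj, tij, tji, sij,
    sji, e, f1, f2, f3, smul_add, smul_zero, mul_zero, add_zero, zero_add, e1, e2]
  module
end sigma

lemma xvec_ne_zero {β : ℕ → ℤ} (hβ : IsPosRoot n β) : xvec F n β ≠ 0 := by
  obtain ⟨b, rfl⟩ := hβ
  simp [xvec_root]

lemma simpleCoord_simple {i j : ℕ} (hn : 2 ≤ n) (hi : 1 ≤ i ∧ i ≤ n) (hj : 1 ≤ j ∧ j ≤ n)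
    (hne : i ≠ j) : simpleCoord F n i (xvec F n (simpleRoot j)) = 0 := by
  obtain ⟨b, hb⟩ := isPosRoot_simpleRoot hn hj.1 hj.2
  have : simpleRoot j ≠ simpleRoot i := by
    intro h
    have h1 := ip_simpleRoot_self hn hi.1 hi.2
    by_cases hA : Adj i j
    · have h2 := ip_simpleRoot_adj hi.1 hi.2 hj.1 hj.2 hA
      rw [h] at h2
      omega
    · have h2 := ip_simpleRoot_not_adj hi.1 hi.2 hj.1 hj.2 hne hA
      rw [h] at h2
      omega
  rw [← hb, xvec_root]
  simp [simpleCoord, hb, this]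

/-! ### The Cohen–Wales representation as a CGW module -/

/-- The Cohen-Wales operators with parameters `t = r³ l⁻¹` and `r⁻¹`, rescaled by `r`. -/
def cwModule (hn : 2 ≤ n) {l r : F} (hl : l ≠ 0) (hr : r ≠ 0) : CGWModule n l r (V F n) where
  -- The choice of t gives the eigenvalue r · t · r⁻⁴ = l⁻¹ on x_{α_k}.
  g k := r • sigma n (r ^ 3 * l⁻¹) r⁻¹ k
  x k := xvec F n (simpleRoot k)
  -- This form is the total coefficient of x_{α_k} in (rσ_k)² + m rσ_k - 1, obtained by expanding
  -- with `tau_tau`.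
  φ k := (r ^ 3 * l⁻¹ * r ^ 2) • cwForm n r⁻¹ k ∘ₗ tau n r⁻¹ k - simpleCoord F n k
    + (r ^ 3 * l⁻¹ * (l⁻¹ * r + 1 - r ^ 2)) • cwForm n r⁻¹ k
  x_ne hk := xvec_ne_zero (isPosRoot_simpleRoot hn hk.1 hk.2)
  comm hi hj h v := by
    simp only [LinearMap.smul_apply, map_smul]
    rw [sigma_comm _ (inv_ne_zero hr) hn hi hj h]
  braid hi hj h v := by
    simp only [LinearMap.smul_apply, map_smul]
    rw [sigma_braid _ (inv_ne_zero hr) hn hi hj h]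
  quad hk v := by
    simp only [sigma_apply, LinearMap.smul_apply, map_smul, map_add, tau_simple_self _ hn hk,
      tau_tau _ hn hk, cwForm_simple_self _ hn hk, LinearMap.sub_apply, LinearMap.add_apply,
      LinearMap.comp_apply, mPar, smul_eq_mul]
    match_scalars <;> field_simp <;> ring
  g_x_self hk := by
    simp only [sigma_apply, LinearMap.smul_apply, tau_simple_self _ hn hk,
      cwForm_simple_self _ hn hk]
    match_scalars
    field_simp
  g_x hi hj hne h := by
    simp only [sigma_apply, LinearMap.smul_apply, tau_simple_nadj _ hn hi hj hne h,
      cwForm_simple_ne (inv_ne_zero hr) hn hi hj hne]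
    simp
  g_x_adj {i j} hi hj h := by
    have hne : i ≠ j := by rintro rfl; unfold Adj at h; omega
    simp only [sigma_apply, LinearMap.smul_apply, tau_simple_adj _ hn hi hj h,
      tau_simple_adj _ hn hj hi h.symm, cwForm_simple_ne (inv_ne_zero hr) hn hi hj hne,
      cwForm_simple_ne (inv_ne_zero hr) hn hj hi hne.symm, mPar, add_comm (simpleRoot i)]
    match_scalars <;> field_simp <;> ring
  g_g_x {i j} hi hj h := by
    have hne : i ≠ j := by rintro rfl; unfold Adj at h; omega
    have e := cwForm_tau_adj (inv_ne_zero hr) hi hj h (xvec F n (simpleRoot i))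
    rw [tau_simple_self _ hn hi, tau_simple_adj _ hn hj hi h.symm] at e
    simp only [map_add, map_smul, map_zero, smul_eq_mul, cwForm_simple_self _ hn hi] at e
    simp only [sigma_apply, LinearMap.smul_apply, tau_simple_adj _ hn hj hi h.symm, map_add,
      map_smul, cwForm_simple_ne (inv_ne_zero hr) hn hj hi hne.symm, tau_simple_self _ hn hi,
      add_comm (simpleRoot i), tau_simple_add _ hn hi hj h, smul_eq_mul,
      cwForm_simple_self _ hn hi] at e ⊢
    have e' : cwForm n r⁻¹ i (xvec F n (simpleRoot j + simpleRoot i)) =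
        -(1 - r⁻¹ ^ 2) * r⁻¹ ^ 3 := by
      refine mul_left_cancel₀ (inv_ne_zero hr) ?_
      linear_combination -e
    rw [cwForm_simple_ne (inv_ne_zero hr) hn hi hj hne, e']
    match_scalars <;> field_simp <;> ring
  φ_x_adj {i j} hi hj h := by
    have hne : i ≠ j := by rintro rfl; unfold Adj at h; omega
    have e := cwForm_tau_adj (inv_ne_zero hr) hi hj h (xvec F n (simpleRoot i))
    rw [tau_simple_self _ hn hi, tau_simple_adj _ hn hj hi h.symm] at e
    simp only [map_add, map_smul, map_zero, smul_eq_mul, cwForm_simple_self _ hn hi] at e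
    simp only [LinearMap.sub_apply, LinearMap.add_apply, LinearMap.smul_apply, map_add, map_smul,
      LinearMap.comp_apply, simpleCoord_simple hn hi hj hne, tau_simple_adj _ hn hi hj h,
      cwForm_simple_ne (inv_ne_zero hr) hn hi hj hne, smul_eq_mul, mPar, mul_zero, zero_add,
      add_zero, sub_zero, add_comm (simpleRoot i)] at e ⊢
    have e' : r⁻¹ * cwForm n r⁻¹ i (xvec F n (simpleRoot j + simpleRoot i)) =
      -(1 - r⁻¹ ^ 2) * r⁻¹ ^ 4 := by linear_combination -e
    rw [e']
    field_simp
    ring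

/-! ### Consequences of the module axioms for the forms φ_k -/

namespace CGWModule

variable {l r : F} {E : Type*} [AddCommGroup E] [Module F E] (M : CGWModule n l r E)

/-- Since g_j commutes with g_i, it commutes with φ_i ⊗ x_i. Comparing coefficients of x_i, with g_j
x_i = r x_i, gives the claim. -/
lemma φ_g {i j : ℕ} (hi : 1 ≤ i ∧ i ≤ n) (hj : 1 ≤ j ∧ j ≤ n) (hne : i ≠ j) (h : ¬ Adj j i)
    (v : E) : M.φ i (M.g j v) = r * M.φ i v := by
  have h1 := M.quad hi (M.g j v)
  rw [← M.comm hj hi h, ← M.comm hj hi h, M.quad hi v] at h1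
  simp only [map_add, map_sub, map_smul, M.g_x hj hi hne.symm h] at h1
  refine smul_left_injective F (M.x_ne hi) ?_
  simp only [mul_smul]
  rw [smul_comm r]
  exact (add_left_cancel h1).symm

/-- The braid relation gives g_i² (g_j g_i) = (g_j g_i) g_j². Compare the rank one parts and use g_j
g_i x_j = x_i. -/
lemma φ_g_g {i j : ℕ} (hi : 1 ≤ i ∧ i ≤ n) (hj : 1 ≤ j ∧ j ≤ n) (h : Adj i j)
    (v : E) : M.φ i (M.g j (M.g i v)) = M.φ j v := by
  have h1 := M.quad hi (M.g j (M.g i v))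
  rw [M.braid hi hj h, M.braid hi hj h, M.quad hj v] at h1
  simp only [map_add, map_sub, map_smul, M.g_g_x hj hi h.symm] at h1
  exact smul_left_injective F (M.x_ne hi) (add_left_cancel h1).symm

lemma φ_g_x {i j : ℕ} (hi : 1 ≤ i ∧ i ≤ n) (hj : 1 ≤ j ∧ j ≤ n) (h : Adj i j) :
    M.φ i (M.g j (M.x i)) = mPar r := by
  have h1 := M.quad hi (M.g j (M.x i))
  rw [M.g_g_x hi hj h] at h1
  have h2 := M.g_x_adj hi hj h
  refine smul_left_injective F (M.x_ne hi) ?_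
  simp only
  rw [h1] at h2
  refine add_left_cancel (a := M.g j (M.x i) - mPar r • M.x j + mPar r • M.x j) ?_
  rw [add_right_comm, h2, sub_add_cancel]

lemma g_injective (hl : l ≠ 0) {k : ℕ} (hk : 1 ≤ k ∧ k ≤ n) : Function.Injective (M.g k) := by
  refine (injective_iff_map_eq_zero _).2 fun v hv => ?_
  have h1 := M.quad hk v
  rw [hv, map_zero, smul_zero, sub_zero] at h1
  have h2 := congrArg (M.g k) h1
  rw [map_zero, map_add, hv, map_smul, M.g_x_self hk, zero_add, smul_smul] at h2
  have h3 : M.φ k v = 0 := by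
    simpa [M.x_ne hk, hl] using h2.symm
  simpa [h3] using h1.symm

/-! ### The vectors u_{st}, û_{st}, raising, and nodes acting by r -/

/-- The vector that corresponds to `w_{st}`. -/
def u (s : ℕ) : ℕ → E
  | 0 => 0
  | t + 1 => if t = s then M.x (s + 1) else M.g (t + 1) (u s t)

/-- The vector that corresponds to `ŵ_{1t}`. -/
def uhOne : ℕ → E
  | 0 => 0
  | t + 1 => if t = 1 then M.x 1 else M.g (t + 1) (uhOne t)

/-- The vector that corresponds to `ŵ_{st}`. -/
def uh (s t : ℕ) : E :=
  match s with
  | 0 => 0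
  | s + 1 => if s = 0 then M.uhOne t else M.g (s + 1) (uh s t)

lemma u_self (s : ℕ) : M.u s (s + 1) = M.x (s + 1) := by simp [u]

lemma u_succ {s t : ℕ} (h : s < t) : M.u s (t + 1) = M.g (t + 1) (M.u s t) := by
  rw [u, if_neg (by omega)]

lemma uh_one_two : M.uh 1 2 = M.x 1 := by simp [uh, uhOne]

lemma uh_one_succ {t : ℕ} (h : 2 ≤ t) : M.uh 1 (t + 1) = M.g (t + 1) (M.uh 1 t) := by
  simp [uh, uhOne, show t ≠ 1 by omega]

lemma uh_succ {s : ℕ} (h : 1 ≤ s) (t : ℕ) : M.uh (s + 1) t = M.g (s + 1) (M.uh s t) := by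
  rw [uh, if_neg (by omega)]

lemma not_adj_of_lt {i j : ℕ} (hi : 2 ≤ i) (hij : i + 1 < j) : ¬ Adj i j := by
  unfold Adj; omega

lemma not_adj_of_gt {i j : ℕ} (hi : 2 ≤ i) (hij : i + 1 < j) : ¬ Adj j i := by
  unfold Adj; omega

lemma adj_succ {i : ℕ} (hi : 2 ≤ i) : Adj i (i + 1) := .inl ⟨hi, rfl⟩

lemma adj_pred {i : ℕ} (hi : 2 ≤ i) : Adj (i + 1) i := (adj_succ hi).symm

lemma uh_snd {s t : ℕ} (hs : 1 ≤ s) (hst : s < t) (ht : t + 1 ≤ n) :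
    M.uh s (t + 1) = M.g (t + 1) (M.uh s t) := by
  induction s, hs using Nat.le_induction with
  | base => exact M.uh_one_succ hst
  | succ s hs ih =>
    rw [M.uh_succ hs, ih (by omega), M.uh_succ hs,
      M.comm (by omega) (by omega) (not_adj_of_lt (by omega) (by omega))]

lemma g_u_fst {s t : ℕ} (hs : 1 ≤ s) (hst : s + 2 ≤ t) (ht : t ≤ n) :
    M.g (s + 1) (M.u s t) = M.u (s + 1) t := by
  induction t, hst using Nat.le_induction with
  | base =>
    rw [M.u_succ (by omega), u_self, u_self, M.g_g_x (by omega) (by omega) (adj_succ (by omega))]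
  | succ t hst ih =>
    rw [M.u_succ (by omega), M.u_succ (by omega),
      M.comm (by omega) (by omega) (not_adj_of_lt (by omega) (by omega)), ih (by omega)]

lemma g_u_far {k s t : ℕ} (hk : 1 ≤ k ∧ k ≤ n) (hst : s < t) (ht : t ≤ n)
    (H : ∀ j, s < j → j ≤ t → k ≠ j ∧ ¬ Adj k j) : M.g k (M.u s t) = r • M.u s t := by
  induction t, hst using Nat.le_induction with
  | base =>
    have := H (s + 1) (by omega) le_rfl
    rw [u_self, M.g_x hk (by omega) this.1 this.2]
  | succ t hst ih =>
    rw [M.u_succ (by omega), M.comm hk (by omega) (H (t + 1) (by omega) le_rfl).2,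
      ih (by omega) fun j h1 h2 => H j h1 (by omega), map_smul]

lemma g_u_low {k s t : ℕ} (hk : 2 ≤ k) (hks : k < s) (hst : s < t) (ht : t ≤ n) :
    M.g k (M.u s t) = r • M.u s t :=
  M.g_u_far (by omega) hst ht fun _ _ _ => ⟨by omega, not_adj_of_lt hk (by omega)⟩

lemma g_u_high {k s t : ℕ} (hs : 1 ≤ s) (hst : s < t) (hk : t + 1 < k) (hkn : k ≤ n) :
    M.g k (M.u s t) = r • M.u s t :=
  M.g_u_far (by omega) hst (by omega) fun _ _ _ =>
    ⟨by omega, not_adj_of_gt (by omega) (by omega)⟩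

/-- For t = k + 1 the vector is g_{k+1} g_k u_{s,k-1}. A braid move brings g_{k+1} next to
u_{s,k-1}, on which it acts by r; larger t follow by commutation. -/
lemma g_u_mid {k s t : ℕ} (hs : 1 ≤ s) (hk : s + 1 < k) (hkt : k < t) (ht : t ≤ n) :
    M.g k (M.u s t) = r • M.u s t := by
  obtain ⟨j, rfl⟩ : ∃ j, k = j + 1 := ⟨k - 1, by omega⟩
  induction t, hkt using Nat.le_induction with
  | base =>
    rw [M.u_succ (by omega), M.u_succ (by omega),
      M.braid (by omega) (by omega) (adj_succ (by omega)),
      M.g_u_high hs (by omega) (by omega) ht, map_smul, map_smul]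
  | succ t hst ih =>
    rw [M.u_succ (by omega), M.comm (by omega) (by omega) (not_adj_of_lt (by omega) (by omega)),
      ih (by omega), map_smul]

lemma g_uh_high {k s t : ℕ} (hs : 1 ≤ s) (hst : s < t) (hk : t + 1 < k) (hkn : k ≤ n) :
    M.g k (M.uh s t) = r • M.uh s t := by
  induction s, hs using Nat.le_induction with
  | base =>
    induction t, hst using Nat.le_induction with
    | base => rw [uh_one_two, M.g_x (by omega) (by omega) (by omega) (by unfold Adj; omega)]
    | succ t hst ih =>
      rw [M.uh_one_succ hst, M.comm (by omega) (by omega) (not_adj_of_gt (by omega) (by omega)),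
        ih (by omega), map_smul]
  | succ s hs ih =>
    rw [M.uh_succ hs, M.comm (by omega) (by omega) (not_adj_of_gt (by omega) (by omega)),
      ih (by omega), map_smul]

lemma g_uh_mid {k s t : ℕ} (hs : 1 ≤ s) (hk : s + 1 < k) (hkt : k < t) (ht : t ≤ n) :
    M.g k (M.uh s t) = r • M.uh s t := by
  induction s, hs using Nat.le_induction with
  | base =>
    obtain ⟨j, rfl⟩ : ∃ j, k = j + 1 := ⟨k - 1, by omega⟩
    induction t, hkt using Nat.le_induction with
    | base =>
      rw [M.uh_one_succ (by omega), M.uh_one_succ (by omega),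
        M.braid (by omega) (by omega) (adj_succ (by omega)),
        M.g_uh_high le_rfl (by omega) (by omega) ht, map_smul, map_smul]
    | succ t hst ih =>
      rw [M.uh_one_succ (by omega),
        M.comm (by omega) (by omega) (not_adj_of_lt (by omega) (by omega)), ih (by omega), map_smul]
  | succ s hs ih =>
    rw [M.uh_succ hs, M.comm (by omega) (by omega) (not_adj_of_gt (by omega) (by omega)),
      ih (by omega), map_smul]

lemma g_uh_low {k s t : ℕ} (hk : 2 ≤ k) (hks : k < s) (hst : s < t) (ht : t ≤ n) :
    M.g k (M.uh s t) = r • M.uh s t := by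
  obtain ⟨j, rfl⟩ : ∃ j, k = j + 1 := ⟨k - 1, by omega⟩
  induction s, hks using Nat.le_induction with
  | base =>
    rw [M.uh_succ (by omega), M.uh_succ (by omega),
      M.braid (by omega) (by omega) (adj_succ (by omega)),
      M.g_uh_mid (by omega) (by omega) hst ht, map_smul, map_smul]
  | succ s hs ih =>
    rw [M.uh_succ (by omega), M.comm (by omega) (by omega) (not_adj_of_lt (by omega) (by omega)),
      ih (by omega), map_smul]

lemma uh_succ_succ {s : ℕ} (hs : 1 ≤ s) (hsn : s + 2 ≤ n) :
    M.uh (s + 1) (s + 2) = M.g (s + 1) (M.g (s + 2) (M.uh s (s + 1))) := by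
  rw [M.uh_succ hs, M.uh_snd hs (by omega) (by omega)]

/-- The braid relation reduces the eigenvalue at s + 1 to the one at s. The base is g_2 x_1 = r x_1,
since nodes 1 and 2 are not adjacent. -/
lemma g_uh_adjacent {s : ℕ} (hs : 1 ≤ s) (hsn : s + 1 ≤ n) :
    M.g (s + 1) (M.uh s (s + 1)) = r • M.uh s (s + 1) := by
  induction s, hs using Nat.le_induction with
  | base => rw [uh_one_two, M.g_x (by omega) (by omega) (by omega) (by unfold Adj; omega)]
  | succ s hs ih =>
    rw [M.uh_succ_succ hs hsn, M.braid (by omega) (by omega) (adj_pred (by omega)), ih (by omega),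
      map_smul, map_smul]

/-! ### Values of φ_k on the vectors and the lowering formulas -/

lemma φ_u_fst (hr : r ≠ 0) {s t : ℕ} (hs : 1 ≤ s) (hst : s + 2 ≤ t) (ht : t ≤ n) :
    M.φ (s + 1) (M.u s t) = mPar r * r ^ ((t : ℤ) - s - 2) := by
  induction t, hst using Nat.le_induction with
  | base =>
    rw [M.u_succ (by omega), u_self, M.φ_g_x (by omega) (by omega) (adj_succ (by omega))]
    push_cast
    rw [show (s : ℤ) + 2 - s - 2 = 0 by ring, zpow_zero, mul_one]
  | succ t hst ih =>
    rw [M.u_succ (by omega), M.φ_g (by omega) (by omega) (by omega)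
      (not_adj_of_gt (by omega) (by omega)), ih (by omega)]
    push_cast
    rw [show (t : ℤ) + 1 - s - 2 = t - s - 2 + 1 by ring, zpow_add_one₀ hr]
    ring

/-- The induction runs downwards in s: u_{s+1,t} = g_{s+1} u_{s,t} and φ_{t+1} g_{s+1} = r φ_{t+1},
so each step costs a factor r⁻¹, starting from φ_{t+1}(x_t) = m/l. -/
lemma φ_u_snd (hr : r ≠ 0) {s t : ℕ} (hs : 1 ≤ s) (hst : s < t) (ht : t + 1 ≤ n) :
    M.φ (t + 1) (M.u s t) = mPar r / (l * r ^ ((t : ℤ) - s - 1)) := by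
  obtain ⟨d, rfl⟩ := Nat.exists_eq_add_of_lt hst
  induction d generalizing s with
  | zero =>
    rw [add_zero, u_self, M.φ_x_adj (by omega) (by omega) (adj_pred (by omega))]
    push_cast
    rw [show (s : ℤ) + 1 - s - 1 = 0 by ring, zpow_zero, mul_one]
  | succ d ih =>
    have h1 := ih (s := s + 1) (by omega) (by omega) (by omega)
    rw [show s + 1 + d + 1 = s + (d + 1) + 1 by ring,
      ← M.g_u_fst hs (by omega) (by omega), M.φ_g (by omega) (by omega) (by omega)
      (not_adj_of_lt (by omega) (by omega))] at h1
    refine mul_left_cancel₀ hr (h1.trans ?_)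
    push_cast
    rw [show (s : ℤ) + (d + 1) + 1 - (s + 1) - 1 = d by ring,
      show (s : ℤ) + (d + 1) + 1 - s - 1 = d + 1 by ring, zpow_add_one₀ hr]
    field_simp

lemma φ_uh_snd_adjacent {s : ℕ} (hs : 1 ≤ s) (hsn : s + 2 ≤ n) :
    M.φ (s + 2) (M.uh s (s + 1)) = mPar r / l := by
  induction s, hs using Nat.le_induction with
  | base => rw [uh_one_two, M.φ_x_adj (by omega) (by omega) (by unfold Adj; omega)]
  | succ s hs ih =>
    -- The factor r produced by g_{s+1} is absorbed as g_{s+3} acting on û_{s,s+1}, which allows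
    -- `φ_g_g` for the nodes s + 3 and s + 2.
    rw [M.uh_succ_succ hs (by omega), M.φ_g (by omega) (by omega) (by omega)
      (not_adj_of_lt (by omega) (by omega)), ← ih (by omega), ← smul_eq_mul, ← map_smul, ← map_smul,
      ← M.g_uh_high (k := s + 3) hs (by omega) (by omega) (by omega),
      M.φ_g_g (by omega) (by omega) (adj_pred (by omega))]

lemma φ_uh_snd (hr : r ≠ 0) {s t : ℕ} (hs : 1 ≤ s) (hst : s < t) (ht : t + 1 ≤ n) :
    M.φ (t + 1) (M.uh s t) = mPar r / (l * r ^ ((t : ℤ) - s - 1)) := by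
  obtain ⟨d, rfl⟩ := Nat.exists_eq_add_of_lt hst
  induction d generalizing s with
  | zero =>
    rw [add_zero, M.φ_uh_snd_adjacent hs (by omega)]
    push_cast
    rw [show (s : ℤ) + 1 - s - 1 = 0 by ring, zpow_zero, mul_one]
  | succ d ih =>
    have h1 := ih (s := s + 1) (by omega) (by omega) (by omega)
    rw [show s + 1 + d + 1 = s + (d + 1) + 1 by ring,
      M.uh_succ hs, M.φ_g (by omega) (by omega) (by omega)
      (not_adj_of_lt (by omega) (by omega))] at h1
    refine mul_left_cancel₀ hr (h1.trans ?_)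
    push_cast
    rw [show (s : ℤ) + (d + 1) + 1 - (s + 1) - 1 = d by ring,
      show (s : ℤ) + (d + 1) + 1 - s - 1 = d + 1 by ring, zpow_add_one₀ hr]
    field_simp

lemma φ_uh_fst (hr : r ≠ 0) {s t : ℕ} (hs : 1 ≤ s) (hst : s + 2 ≤ t) (ht : t ≤ n) :
    M.φ (s + 1) (M.uh s t) = mPar r / l * r ^ ((t : ℤ) - s - 3) := by
  induction t, hst using Nat.le_induction with
  | base =>
    have h1 := M.φ_uh_snd_adjacent hs ht
    -- Here `φ_g_g` moves the known value of φ_{s+2} to φ_{s+1}; the factor r from g_{s+1} û_{s,s+1}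
    -- explains the exponent -1.
    rw [← M.φ_g_g (by omega) (by omega) (adj_succ (by omega)), M.g_uh_adjacent hs (by omega),
      map_smul, map_smul, ← M.uh_snd hs (by omega) (by omega), smul_eq_mul] at h1
    refine mul_left_cancel₀ hr (h1.trans ?_)
    push_cast
    rw [show (s : ℤ) + 2 - s - 3 = -1 by ring, zpow_neg_one]
    field_simp
  | succ t hst ih =>
    rw [M.uh_snd hs (by omega) (by omega), M.φ_g (by omega) (by omega) (by omega)
      (not_adj_of_gt (by omega) (by omega)), ih (by omega)]
    push_cast
    rw [show (t : ℤ) + 1 - s - 3 = t - s - 3 + 1 by ring, zpow_add_one₀ hr]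
    ring

/-- Lowering applies g twice to an unraised vector, so it is the quadratic relation; φ supplies the
coefficient of the simple root vector. The three lemmas that follow have the same source. -/
lemma g_u_fst_down (hr : r ≠ 0) {s t : ℕ} (hs : 1 ≤ s) (hst : s + 2 ≤ t) (ht : t ≤ n) :
    M.g (s + 1) (M.u (s + 1) t) = M.u s t + (mPar r * r ^ ((t : ℤ) - s - 2)) • M.u s (s + 1)
      - mPar r • M.u (s + 1) t := by
  rw [← M.g_u_fst hs hst ht, M.quad (by omega), M.φ_u_fst hr hs hst ht, u_self]
  abel

lemma g_u_snd_down (hr : r ≠ 0) {s t : ℕ} (hs : 1 ≤ s) (hst : s < t) (ht : t + 1 ≤ n) :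
    M.g (t + 1) (M.u s (t + 1)) = M.u s t + (mPar r / (l * r ^ ((t : ℤ) - s - 1))) • M.u t (t + 1)
      - mPar r • M.u s (t + 1) := by
  rw [M.u_succ hst, M.quad (by omega), M.φ_u_snd hr hs hst ht, u_self]
  abel

lemma g_uh_fst_down (hr : r ≠ 0) {s t : ℕ} (hs : 1 ≤ s) (hst : s + 2 ≤ t) (ht : t ≤ n) :
    M.g (s + 1) (M.uh (s + 1) t) = M.uh s t + (mPar r / l * r ^ ((t : ℤ) - s - 3)) • M.u s (s + 1)
      - mPar r • M.uh (s + 1) t := by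
  rw [M.uh_succ hs, M.quad (by omega), M.φ_uh_fst hr hs hst ht, u_self]
  abel

lemma g_uh_snd_down (hr : r ≠ 0) {s t : ℕ} (hs : 1 ≤ s) (hst : s < t) (ht : t + 1 ≤ n) :
    M.g (t + 1) (M.uh s (t + 1)) = M.uh s t + (mPar r / (l * r ^ ((t : ℤ) - s - 1))) • M.u t (t + 1)
      - mPar r • M.uh s (t + 1) := by
  rw [M.uh_snd hs hst ht, M.quad (by omega), M.φ_uh_snd hr hs hst ht, u_self]
  abel

/-! ### The action of g_1 -/

lemma g_one_u_far {s t : ℕ} (hs : 3 ≤ s) (hst : s < t) (ht : t ≤ n) :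
    M.g 1 (M.u s t) = r • M.u s t :=
  M.g_u_far (by omega) hst ht fun _ _ _ => ⟨by omega, by unfold Adj; omega⟩

lemma g_one_u_one_two (hn : 2 ≤ n) : M.g 1 (M.u 1 2) = r • M.u 1 2 := by
  rw [u_self, M.g_x (by omega) (by omega) (by omega) (by unfold Adj; omega)]

lemma g_one_uh_one_two (hn : 2 ≤ n) : M.g 1 (M.uh 1 2) = l⁻¹ • M.uh 1 2 := by
  rw [uh_one_two, M.g_x_self (by omega)]

lemma g_one_uh_one {t : ℕ} (h3 : 3 ≤ t) (ht : t ≤ n) : M.g 1 (M.uh 1 t) = M.u 2 t := by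
  induction t, h3 using Nat.le_induction with
  | base =>
    rw [M.uh_one_succ le_rfl, uh_one_two, u_self, M.g_g_x (by omega) (by omega) (by unfold Adj; omega)]
  | succ t hst ih =>
    rw [M.uh_one_succ (by omega), M.u_succ (by omega),
      M.comm (by omega) (by omega) (by unfold Adj; omega), ih (by omega)]

lemma φ_one_uh_one (hr : r ≠ 0) {t : ℕ} (h3 : 3 ≤ t) (ht : t ≤ n) :
    M.φ 1 (M.uh 1 t) = mPar r * r ^ ((t : ℤ) - 3) := by
  induction t, h3 using Nat.le_induction with
  | base =>
    rw [M.uh_one_succ le_rfl, uh_one_two, M.φ_g_x (by omega) (by omega) (by unfold Adj; omega)]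
    simp
  | succ t hst ih =>
    rw [M.uh_one_succ (by omega), M.φ_g (by omega) (by omega) (by omega)
      (by unfold Adj; omega), ih (by omega)]
    push_cast
    rw [show (t : ℤ) + 1 - 3 = t - 3 + 1 by ring, zpow_add_one₀ hr]
    ring

lemma g_two_u_two (hr : r ≠ 0) {t : ℕ} (h3 : 3 ≤ t) (ht : t ≤ n) :
    M.g 2 (M.u 2 t) = M.u 1 t + (mPar r * r ^ ((t : ℤ) - 3)) • M.u 1 2 - mPar r • M.u 2 t := by
  have := M.g_u_fst_down hr (s := 1) le_rfl h3 ht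
  norm_num at this
  rw [this, show (t : ℤ) - 1 - 2 = t - 3 by ring]

lemma g_one_uh_two (hr : r ≠ 0) {t : ℕ} (h3 : 3 ≤ t) (ht : t ≤ n) :
    M.g 1 (M.uh 2 t) =
      M.u 1 t + (mPar r * r ^ ((t : ℤ) - 3)) • M.u 1 2 - mPar r • M.u 2 t := by
  rw [M.uh_succ le_rfl, M.comm (by omega) (by omega) (by unfold Adj; omega),
    M.g_one_uh_one h3 ht, M.g_two_u_two hr h3 ht]

lemma g_one_u_two (hr : r ≠ 0) {t : ℕ} (h3 : 3 ≤ t) (ht : t ≤ n) :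
    M.g 1 (M.u 2 t) =
      M.uh 1 t + (mPar r * r ^ ((t : ℤ) - 3)) • M.uh 1 2 - mPar r • M.u 2 t := by
  rw [← M.g_one_uh_one h3 ht, M.quad (by omega), M.φ_one_uh_one hr h3 ht, M.g_one_uh_one h3 ht,
    uh_one_two]
  abel

/-- Solve the lowering formula for u_{1t} in terms of g_2 u_{2t}, then use that g_1 and g_2 commute.
-/
lemma g_one_u_one (hr : r ≠ 0) {t : ℕ} (h3 : 3 ≤ t) (ht : t ≤ n) :
    M.g 1 (M.u 1 t) =
      M.uh 2 t + (mPar r * r ^ ((t : ℤ) - 4)) • (M.uh 1 2 - M.u 1 2)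
        + mPar r • (M.uh 1 t - M.u 1 t) := by
  have e : M.u 1 t =
      M.g 2 (M.u 2 t) - (mPar r * r ^ ((t : ℤ) - 3)) • M.u 1 2 + mPar r • M.u 2 t := by
    rw [M.g_two_u_two hr h3 ht]; abel
  have e2 : M.g 2 (M.uh 1 t) = M.uh 2 t := (M.uh_succ le_rfl t).symm
  have e3 : M.g 2 (M.uh 1 2) = r • M.uh 1 2 := M.g_uh_adjacent le_rfl (by omega)
  have e4 : M.g 1 (M.g 2 (M.u 2 t)) = M.g 2 (M.g 1 (M.u 2 t)) :=
    M.comm (by omega) (by omega) (by unfold Adj; omega) _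
  conv_lhs => rw [e]
  simp only [map_add, map_sub, map_smul, e4, M.g_one_u_two hr h3 ht]
  simp only [map_add, map_sub, map_smul, e2, e3,
    M.g_two_u_two hr h3 ht, M.g_one_u_one_two (by omega)]
  rw [show (t : ℤ) - 3 = t - 4 + 1 by ring, zpow_add_one₀ hr, mPar]
  match_scalars <;> field_simp <;> ring1

/-- Both sides are compared after applying the injective g_3: since û_{3t} = g_3 û_{2t}, the braid
relation turns g_3 g_1 g_3 into g_1 g_3 g_1, and g_1 û_{2t} is known. -/
lemma g_one_uh_three (hl : l ≠ 0) (hr : r ≠ 0) {t : ℕ} (h3 : 4 ≤ t) (ht : t ≤ n) :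
    M.g 1 (M.uh 3 t) =
      (mPar r * r ^ ((t : ℤ) - 5)) • (M.uh 1 3 - M.u 1 3)
      + (mPar r * r ^ ((t : ℤ) - 4)) • (M.uh 2 3 - M.u 2 3)
      + mPar r • (M.uh 1 t - M.u 1 t)
      + (mPar r * r) • (M.uh 2 t - M.u 2 t)
      + (mPar r ^ 2 * (r ^ ((t : ℤ) - 5) + r ^ ((t : ℤ) - 3))) • (M.uh 1 2 - M.u 1 2)
      + r • M.uh 3 t := by
  apply M.g_injective hl (k := 3) (by omega)
  have e1 : M.g 3 (M.g 1 (M.uh 3 t)) = r • M.g 1 (M.u 1 t) +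
      (mPar r * r ^ ((t : ℤ) - 3)) • M.g 1 (M.u 1 3) - mPar r • M.g 1 (M.u 3 t) := by
    rw [M.uh_succ (by omega : 1 ≤ 2), M.braid (by omega) (by omega) (by unfold Adj; omega),
      M.g_one_uh_two hr (by omega) ht]
    simp only [map_add, map_sub, map_smul]
    rw [M.g_u_mid le_rfl (by omega) (by omega) ht, M.g_u_fst (by omega) (by omega) ht,
      ← M.u_succ (by omega), map_smul]
  have a1 := M.g_uh_snd_down hr (s := 1) (t := 2) le_rfl (by omega) (by omega)
  have a2 := M.g_u_snd_down hr (s := 1) (t := 2) le_rfl (by omega) (by omega)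
  have a3 := M.g_uh_adjacent (s := 2) (by omega) (by omega)
  have a4 : M.g 3 (M.u 2 3) = l⁻¹ • M.u 2 3 := by rw [u_self, M.g_x_self (by omega)]
  have a5 := M.g_uh_mid (k := 3) (s := 1) (t := t) le_rfl (by omega) (by omega) ht
  have a6 := M.g_u_mid (k := 3) (s := 1) (t := t) le_rfl (by omega) (by omega) ht
  have a7 := M.uh_succ (s := 2) (by omega) t
  have a8 := M.g_u_fst (s := 2) (by omega) (by omega) ht
  have a9 := M.uh_one_succ (t := 2) (by omega)
  have a10 := M.u_succ (s := 1) (t := 2) (by omega)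
  have a11 := M.g_uh_fst_down hr (s := 2) (by omega) (by omega) ht
  norm_num at a1 a2 a3 a5 a6 a7 a8 a9 a10 a11
  rw [e1]
  simp only [map_add, map_sub, map_smul, a1, a2, a3, a4, a5, a6, ← a7, a8, ← a9, ← a10, a11,
    M.g_one_u_one hr (by omega : 3 ≤ t) ht, M.g_one_u_one hr (by omega : 3 ≤ 3) (by omega),
    M.g_one_u_far (by omega : 3 ≤ 3) (by omega) ht]
  push_cast
  rw [show (t : ℤ) - 3 = t - 5 + 1 + 1 by ring, show (t : ℤ) - 4 = t - 5 + 1 by ring,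
    show (t : ℤ) - 2 - 3 = t - 5 by ring,
    zpow_neg_one]
  simp only [zpow_add_one₀ hr, mPar]
  match_scalars <;> field_simp <;> ring1

/-- From s = 3 on, the raising operator g_{s+1} commutes with g_1, so it carries the formula for s
to the one for s + 1. -/
lemma g_one_uh_far (hl : l ≠ 0) (hr : r ≠ 0) {s t : ℕ} (hs : 3 ≤ s) (hst : s < t) (ht : t ≤ n) :
    M.g 1 (M.uh s t) =
      (mPar r * r ^ ((t : ℤ) - 5)) • (M.uh 1 s - M.u 1 s)
      + (mPar r * r ^ ((t : ℤ) - 4)) • (M.uh 2 s - M.u 2 s)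
      + (mPar r * r ^ ((s : ℤ) - 3)) • (M.uh 1 t - M.u 1 t)
      + (mPar r * r ^ ((s : ℤ) - 2)) • (M.uh 2 t - M.u 2 t)
      + (mPar r ^ 2 * (r ^ ((s : ℤ) + t - 8) + r ^ ((s : ℤ) + t - 6))) • (M.uh 1 2 - M.u 1 2)
      + r • M.uh s t := by
  induction s, hs using Nat.le_induction with
  | base =>
    rw [M.g_one_uh_three hl hr hst ht]
    push_cast
    rw [show (3 : ℤ) + t - 8 = t - 5 by ring, show (3 : ℤ) + t - 6 = t - 3 by ring]
    norm_num
  | succ s hs ih =>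
    rw [M.uh_succ (by omega), M.comm (by omega) (by omega) (by unfold Adj; omega), ih (by omega)]
    simp only [map_add, map_sub, map_smul]
    rw [← M.uh_snd (s := 1) le_rfl (by omega) (by omega), ← M.u_succ (s := 1) (by omega),
      ← M.uh_snd (s := 2) (by omega) (by omega) (by omega), ← M.u_succ (s := 2) (by omega),
      M.g_uh_mid (s := 1) le_rfl (by omega) hst ht, M.g_u_mid (s := 1) le_rfl (by omega) hst ht,
      M.g_uh_mid (s := 2) (by omega) (by omega) hst ht,
      M.g_u_mid (s := 2) (by omega) (by omega) hst ht,
      M.g_uh_high (s := 1) (t := 2) le_rfl (by omega) (by omega) (by omega),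
      M.g_u_high (s := 1) (t := 2) le_rfl (by omega) (by omega) (by omega)]
    push_cast
    rw [show (s : ℤ) + 1 - 3 = s - 3 + 1 by ring, show (s : ℤ) + 1 - 2 = s - 2 + 1 by ring,
      show (s : ℤ) + 1 + t - 8 = s + t - 8 + 1 by ring,
      show (s : ℤ) + 1 + t - 6 = s + t - 6 + 1 by ring]
    simp only [zpow_add_one₀ hr]
    module

end CGWModule

/-! ### The intertwiner and the action of the CGW algebra -/

namespace CGWModule

variable {l r : F} {E : Type*} [AddCommGroup E] [Module F E] (M : CGWModule n l r E)

/-- The vector that corresponds to `w_{st}` (for `h = false`) or `ŵ_{st}` (for `h = true`). -/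
def ubar (h : Bool) (s t : ℕ) : E := if h then M.uh s t else M.u s t

/-- The linear map `w_{st} ↦ u_{st}`, `ŵ_{st} ↦ û_{st}`. -/
def intertwiner : V F n →ₗ[F] E :=
  Finsupp.linearCombination F fun b : Label n => M.ubar b.1.2.2 b.1.1 b.1.2.1

lemma intertwiner_wbar {h : Bool} {s t : ℕ} (hs : 1 ≤ s) (hst : s < t) (ht : t ≤ n) :
    M.intertwiner (wbar F n h s t) = M.ubar h s t := by
  rw [wbar_eq_single ⟨hs, hst, ht⟩]
  rw [intertwiner, Finsupp.linearCombination_single, one_smul]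
  rfl

lemma intertwiner_w {s t : ℕ} (hs : 1 ≤ s) (hst : s < t) (ht : t ≤ n) :
    M.intertwiner (w F n s t) = M.u s t := M.intertwiner_wbar hs hst ht

lemma intertwiner_wh {s t : ℕ} (hs : 1 ≤ s) (hst : s < t) (ht : t ≤ n) :
    M.intertwiner (wh F n s t) = M.uh s t := M.intertwiner_wbar hs hst ht

lemma intertwiner_nuTwo (hr : r ≠ 0) {k : ℕ} {h : Bool} {s t : ℕ} (h2 : 2 ≤ k) (hk : k ≤ n)
    (hs : 1 ≤ s) (hst : s < t) (ht : t ≤ n) :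
    M.intertwiner (nuTwo n l r k h s t) = M.g k (M.ubar h s t) := by
  unfold nuTwo
  dsimp only
  split_ifs with c1 c2 c3 c4 c5 c6 c7 c8
  · obtain ⟨rfl, c1⟩ := c1
    rw [M.intertwiner_wbar (by omega) (by omega) ht]
    cases h
    · exact (M.g_u_fst hs c1 ht).symm
    · exact M.uh_succ hs t
  · subst c2
    rw [M.intertwiner_wbar hs (by omega) (by omega)]
    cases h
    · exact M.u_succ hst
    · exact M.uh_snd hs hst hk
  · obtain ⟨rfl, rfl, rfl⟩ := c3
    rw [map_smul, M.intertwiner_wh hs hst ht]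
    exact (M.g_uh_adjacent hs hk).symm
  · obtain ⟨rfl, rfl, rfl⟩ := c4
    rw [map_smul, M.intertwiner_w hs hst ht]
    simp only [ubar, Bool.false_eq_true, if_false, u_self]
    exact (M.g_x_self (by omega)).symm
  · obtain ⟨rfl, rfl⟩ := c5
    obtain ⟨s, rfl⟩ : ∃ a, k = a + 1 := ⟨k - 1, by omega⟩
    have := M.g_uh_fst_down hr (s := s) (t := t) (by omega) (by omega) ht
    simp only [ubar, if_true, this, Nat.add_sub_cancel, map_add, map_sub, map_smul]
    rw [M.intertwiner_wh (by omega) (by omega) ht, M.intertwiner_wh (by omega) (by omega) ht,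
      M.intertwiner_w (by omega) (by omega) (by omega)]
    push_cast
    rw [show (t : ℤ) - (s + 1) - 2 = t - s - 3 by ring]
  · obtain ⟨rfl, c6, rfl⟩ := c6
    obtain ⟨t, rfl⟩ : ∃ a, k = a + 1 := ⟨k - 1, by omega⟩
    have := M.g_uh_snd_down hr (s := s) (t := t) (by omega) (by omega) ht
    simp only [ubar, if_true, this, Nat.add_sub_cancel, map_add, map_sub, map_smul]
    rw [M.intertwiner_wh (by omega) (by omega) ht, M.intertwiner_wh (by omega) (by omega) (by omega),
      M.intertwiner_w (by omega) (by omega) (by omega)]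
    push_cast
    rw [show (t : ℤ) + 1 - s - 2 = t - s - 1 by ring]
  · obtain ⟨rfl, rfl⟩ := c7
    obtain ⟨s, rfl⟩ : ∃ a, k = a + 1 := ⟨k - 1, by omega⟩
    have := M.g_u_fst_down hr (s := s) (t := t) (by omega) (by omega) ht
    simp only [ubar, Bool.false_eq_true, if_false, this, Nat.add_sub_cancel, map_add, map_sub,
      map_smul]
    rw [M.intertwiner_w (by omega) (by omega) ht, M.intertwiner_w (by omega) (by omega) ht,
      M.intertwiner_w (by omega) (by omega) (by omega)]
    push_cast
    rw [show (t : ℤ) - (s + 1) - 1 = t - s - 2 by ring]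
  · obtain ⟨rfl, c6, rfl⟩ := c8
    obtain ⟨t, rfl⟩ : ∃ a, k = a + 1 := ⟨k - 1, by omega⟩
    have := M.g_u_snd_down hr (s := s) (t := t) (by omega) (by omega) ht
    simp only [ubar, Bool.false_eq_true, if_false, this, Nat.add_sub_cancel, map_add, map_sub,
      map_smul]
    rw [M.intertwiner_w (by omega) (by omega) ht, M.intertwiner_w (by omega) (by omega) (by omega),
      M.intertwiner_w (by omega) (by omega) (by omega)]
    push_cast
    rw [show (t : ℤ) + 1 - s - 2 = t - s - 1 by ring]
  · rw [map_smul, M.intertwiner_wbar hs hst ht]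
    -- The default case leaves k outside {s, s + 1, t, t + 1}, hence in one of three ranges.
    have : k < s ∨ (s + 1 < k ∧ k < t) ∨ t + 1 < k := by
      cases h <;> simp at c1 c2 c3 c4 c5 c6 c7 c8 <;> omega
    cases h
    · obtain h1 | ⟨h1, h1'⟩ | h1 := this
      · exact (M.g_u_low h2 h1 hst ht).symm
      · exact (M.g_u_mid hs h1 h1' ht).symm
      · exact (M.g_u_high hs hst h1 hk).symm
    · obtain h1 | ⟨h1, h1'⟩ | h1 := this
      · exact (M.g_uh_low h2 h1 hst ht).symm
      · exact (M.g_uh_mid hs h1 h1' ht).symm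
      · exact (M.g_uh_high hs hst h1 hk).symm

lemma intertwiner_nuOne (hl : l ≠ 0) (hr : r ≠ 0) {h : Bool} {s t : ℕ}
    (hs : 1 ≤ s) (hst : s < t) (ht : t ≤ n) :
    M.intertwiner (nuOne n l r h s t) = M.g 1 (M.ubar h s t) := by
  unfold nuOne
  dsimp only
  split_ifs with c1 c2 c3 c4 c5 c6
  · obtain ⟨rfl, h3⟩ := c1
    have := M.g_one_uh_far hl hr h3 hst ht
    simp only [ubar, if_true, this, map_add, map_sub, map_smul]
    rw [M.intertwiner_wh (s := 1) le_rfl (by omega) (by omega),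
      M.intertwiner_wh (s := 1) le_rfl (by omega) (by omega),
      M.intertwiner_wh (s := 1) le_rfl (by omega) (by omega),
      M.intertwiner_wh (s := 2) (by omega) (by omega) (by omega),
      M.intertwiner_wh (s := 2) (by omega) (by omega) (by omega),
      M.intertwiner_w (s := 1) le_rfl (by omega) (by omega),
      M.intertwiner_w (s := 1) le_rfl (by omega) (by omega),
      M.intertwiner_w (s := 1) le_rfl (by omega) (by omega),
      M.intertwiner_w (s := 2) (by omega) (by omega) (by omega),
      M.intertwiner_w (s := 2) (by omega) (by omega) (by omega),
      M.intertwiner_wh hs hst ht]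
  · obtain ⟨rfl, rfl, h3⟩ := c2
    rw [M.intertwiner_w (by omega) (by omega) ht]
    exact (M.g_one_uh_one h3 ht).symm
  · obtain ⟨rfl, rfl, h3⟩ := c3
    have := M.g_one_uh_two hr h3 ht
    simp only [ubar, if_true, this, map_add, map_sub, map_smul]
    rw [M.intertwiner_w (by omega) (by omega) ht, M.intertwiner_w (by omega) (by omega) (by omega),
      M.intertwiner_w (by omega) (by omega) ht]
  · obtain ⟨rfl, rfl, h3⟩ := c4
    have := M.g_one_u_two hr h3 ht
    simp only [ubar, Bool.false_eq_true, if_false, this, map_add, map_sub, map_smul]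
    rw [M.intertwiner_wh (by omega) (by omega) ht,
      M.intertwiner_wh (by omega) (by omega) (by omega), M.intertwiner_w (by omega) (by omega) ht]
  · obtain ⟨rfl, rfl, h3⟩ := c5
    have := M.g_one_u_one hr h3 ht
    simp only [ubar, Bool.false_eq_true, if_false, this, map_add, map_sub, map_smul]
    rw [M.intertwiner_wh (by omega) (by omega) ht,
      M.intertwiner_wh (by omega) (by omega) (by omega),
      M.intertwiner_w (by omega) (by omega) (by omega),
      M.intertwiner_wh (by omega) (by omega) ht, M.intertwiner_w (by omega) (by omega) ht]
  · obtain ⟨rfl, rfl, rfl⟩ := c6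
    rw [map_smul, M.intertwiner_wh hs hst ht]
    exact (M.g_one_uh_one_two ht).symm
  · rw [map_smul, M.intertwiner_wbar hs hst ht]
    cases h
    · simp at c4 c5
      obtain ⟨rfl, rfl⟩ | h3 : (s = 1 ∧ t = 2) ∨ 3 ≤ s := by omega
      · exact (M.g_one_u_one_two ht).symm
      · exact (M.g_one_u_far h3 hst ht).symm
    · simp at c1 c2 c3 c6
      omega

lemma intertwiner_nu (hl : l ≠ 0) (hr : r ≠ 0) (k : Node n) (v : V F n) :
    M.intertwiner (nu n l r k v) = M.g k.1 (M.intertwiner v) := by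
  suffices H : M.intertwiner ∘ₗ nu n l r k = M.g k.1 ∘ₗ M.intertwiner from DFunLike.congr_fun H v
  refine linearMap_ext_wbar fun h s t hs hst ht => ?_
  have hk := k.2
  rw [LinearMap.comp_apply, LinearMap.comp_apply, M.intertwiner_wbar hs hst ht]
  have e : nu n l r k (wbar F n h s t) =
      if k.1 = 1 then nuOne n l r h s t else nuTwo n l r k.1 h s t := by
    rw [wbar_eq_single ⟨hs, hst, ht⟩]
    rw [nu, Finsupp.linearCombination_single, one_smul]
    rfl
  rw [e]
  split_ifs with h1
  · rw [h1, M.intertwiner_nuOne hl hr hs hst ht]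
  · rw [M.intertwiner_nuTwo hr (by omega) hk.2 hs hst ht]

/-- The rank one operator `e_k`. -/
def e (k : ℕ) : Module.End F E := (l / mPar r) • (M.φ k).smulRight (M.x k)

lemma e_apply (k : ℕ) (v : E) : M.e k v = (l / mPar r) • M.φ k v • M.x k := rfl

/-- The representation of the CGW algebra. -/
def rep (hm : mPar r ≠ 0) : CGW n l r →ₐ[F] Module.End F E :=
  RingQuot.liftAlgHom F ⟨FreeAlgebra.lift F (Sum.elim (fun k : Node n => M.g k.1) fun k => M.e k.1), by
    intro a b hab
    cases hab with
    | comm i j h =>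
      ext v
      simp [freeG, M.comm i.2 j.2 h]
    | braid i j h =>
      ext v
      simp [freeG, M.braid i.2 j.2 h]
    | quad i =>
      ext v
      simp only [freeG, freeE, map_smul, map_sub, map_add, map_mul, map_one, FreeAlgebra.lift_ι_apply,
        Sum.elim_inl, Sum.elim_inr, LinearMap.smul_apply, LinearMap.sub_apply, LinearMap.add_apply,
        pow_two, Module.End.mul_apply, Module.End.one_apply, M.quad i.2, e_apply]
      match_scalars <;> field_simp <;> ring
    | deloop i =>
      ext v
      simp only [freeG, freeE, map_smul, map_mul, FreeAlgebra.lift_ι_apply, Sum.elim_inl,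
        Sum.elim_inr, LinearMap.smul_apply, Module.End.mul_apply, e_apply, M.g_x_self i.2]
      module
    | deloop_adj i j h =>
      ext v
      simp only [freeG, freeE, map_smul, map_mul, FreeAlgebra.lift_ι_apply, Sum.elim_inl,
        Sum.elim_inr, LinearMap.smul_apply, Module.End.mul_apply, e_apply, M.φ_g_x i.2 j.2 h]
      match_scalars
      simp
      field_simp⟩

lemma rep_g (hm : mPar r ≠ 0) (k : Node n) : M.rep hm (CGW.g l r k) = M.g k.1 := by
  rw [rep, CGW.g, RingQuot.liftAlgHom_mkAlgHom_apply, freeG, FreeAlgebra.lift_ι_apply, Sum.elim_inl]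

end CGWModule

/-! ### The dimension of V_n -/

/-- The labels correspond to the ordered pairs of distinct elements of `{1, …, n}`. -/
def labelEquiv (n : ℕ) : Label n ≃ (Finset.Icc 1 n).offDiag where
  toFun b := if b.1.2.2 then ⟨(b.1.2.1, b.1.1), by
      have := b.2; simp only [Finset.mem_offDiag, Finset.mem_Icc]; omega⟩
    else ⟨(b.1.1, b.1.2.1), by
      have := b.2; simp only [Finset.mem_offDiag, Finset.mem_Icc]; omega⟩
  invFun p := if h : p.1.1 < p.1.2 then mkLabel false p.1.1 p.1.2 (by
      have := p.2; simp only [Finset.mem_offDiag, Finset.mem_Icc] at this; omega)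
    else mkLabel true p.1.2 p.1.1 (by
      have := p.2; simp only [Finset.mem_offDiag, Finset.mem_Icc] at this; omega)
  left_inv b := by
    obtain ⟨h, s, t, H, rfl⟩ := exists_mkLabel b
    cases h
    · exact dif_pos H.2.1
    · exact dif_neg H.2.1.le.not_gt
  right_inv p := by
    obtain ⟨⟨a, b⟩, hp⟩ := p
    by_cases h : a < b <;> simp [mkLabel, h]

instance : Finite (Label n) := Finite.of_equiv _ (labelEquiv n).symm

lemma finrank_V (F : Type) [Field F] (n : ℕ) : Module.finrank F (V F n) = n ^ 2 - n := by
  have := Fintype.ofFinite (Label n)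
  rw [Module.finrank_finsupp_self, Fintype.card_congr (labelEquiv n), Fintype.card_coe,
    Finset.offDiag_card]
  simp [pow_two]

/-! ### Bijectivity of the intertwiner for the Cohen–Wales module -/

section bijective

variable {l r : F} (hn : 2 ≤ n) (hl : l ≠ 0) (hr : r ≠ 0)

lemma sigma_mem_range (k : ℕ) (hk : 1 ≤ k ∧ k ≤ n) {v : V F n}
    (hv : v ∈ LinearMap.range (cwModule hn hl hr).intertwiner) :
    sigma n (r ^ 3 * l⁻¹) r⁻¹ k v ∈ LinearMap.range (cwModule hn hl hr).intertwiner := by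
  obtain ⟨v, rfl⟩ := hv
  have h := (cwModule hn hl hr).intertwiner_nu hl hr ⟨k, hk⟩ v
  refine (Submodule.smul_mem_iff _ hr).1 ⟨_, h⟩

lemma simple_mem_range (k : ℕ) (hk : 1 ≤ k ∧ k ≤ n) :
    xvec F n (simpleRoot k) ∈ LinearMap.range (cwModule hn hl hr).intertwiner := by
  obtain rfl | h2 : k = 1 ∨ 2 ≤ k := by omega
  · exact ⟨wh F n 1 2, by
      rw [CGWModule.intertwiner_wh _ le_rfl one_lt_two hn, CGWModule.uh_one_two]; rfl⟩
  · obtain ⟨s, rfl⟩ : ∃ a, k = a + 1 := ⟨k - 1, by omega⟩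
    exact ⟨w F n s (s + 1), by
      rw [CGWModule.intertwiner_w _ (by omega) (by omega) hk.2, CGWModule.u_self]; rfl⟩

/-- This is the climbing step: σ_k v differs from r⁻¹ v' only by multiples of v and x_{α_k}, all of
which lie in the range. -/
lemma mem_range_of_tau (k : ℕ) (hk : 1 ≤ k ∧ k ≤ n) {v v' : V F n}
    (hv : v ∈ LinearMap.range (cwModule hn hl hr).intertwiner)
    (h : tau n r⁻¹ k v = (1 - r⁻¹ ^ 2) • v + r⁻¹ • v') :
    v' ∈ LinearMap.range (cwModule hn hl hr).intertwiner := by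
  have h1 := sigma_mem_range hn hl hr k hk hv
  rw [sigma_apply, h] at h1
  have h2 := Submodule.smul_mem _ ((r ^ 3 * l⁻¹ * cwForm n r⁻¹ k v)) (simple_mem_range hn hl hr k hk)
  have h3 := Submodule.smul_mem _ (1 - r⁻¹ ^ 2) hv
  rw [← Submodule.smul_mem_iff _ (inv_ne_zero hr)]
  have h4 := Submodule.sub_mem _ (Submodule.sub_mem _ h1 h2) h3
  rwa [add_sub_cancel_right, add_sub_cancel_left] at h4

lemma intertwiner_surjective : Function.Surjective (cwModule hn hl hr).intertwiner := by
  rw [← LinearMap.range_eq_top]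
  have base : ∀ s, 1 ≤ s → s + 1 ≤ n →
      wbar F n false s (s + 1) ∈ LinearMap.range (cwModule hn hl hr).intertwiner := by
    intro s hs hsn
    have := simple_mem_range hn hl hr (s + 1) (by omega)
    rwa [simpleRoot_eq (by omega), xvec_rootVec (by omega)] at this
  have key : ∀ h s t, 1 ≤ s → s < t → t ≤ n →
      wbar F n h s t ∈ LinearMap.range (cwModule hn hl hr).intertwiner := by
    intro h s t hs hst ht
    cases h
    · induction t, hst using Nat.le_induction with
      | base => exact base s hs ht
      | succ t hst ih =>
        exact mem_range_of_tau hn hl hr (t + 1) (by omega) (ih (by omega))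
          (tau_wbar_snd_up _ rfl hs hst ht)
    · induction s, hs using Nat.le_induction with
      | base =>
        induction t, hst using Nat.le_induction with
        | base =>
          have := simple_mem_range hn hl hr 1 (by omega)
          rwa [simpleRoot_one, xvec_rootVec (by omega)] at this
        | succ t hst ih =>
          exact mem_range_of_tau hn hl hr (t + 1) (by omega) (ih (by omega))
            (tau_wbar_snd_up _ rfl le_rfl hst ht)
      | succ s hs ih =>
        exact mem_range_of_tau hn hl hr (s + 1) (by omega) (ih (by omega))
            (tau_wh_fst_up _ rfl hs hst ht)
  refine eq_top_iff.2 fun v _ => ?_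
  induction v using Finsupp.induction_linear with
  | zero => exact Submodule.zero_mem _
  | add v v' hv hv' => exact Submodule.add_mem _ (hv trivial) (hv' trivial)
  | single b c =>
    obtain ⟨h, s, t, H, rfl⟩ := exists_mkLabel b
    have := Submodule.smul_mem _ c (key h s t H.1 H.2.1 H.2.2)
    rwa [wbar_eq_single H, Finsupp.smul_single_one] at this

/-- The equivalence between `ν` and the rescaled Cohen-Wales representation. -/
def cwEquiv : V F n ≃ₗ[F] V F n :=
  LinearEquiv.ofBijective (cwModule hn hl hr).intertwiner
    ⟨LinearMap.injective_iff_surjective.2 (intertwiner_surjective hn hl hr),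
      intertwiner_surjective hn hl hr⟩

lemma cwEquiv_nu (k : Node n) (v : V F n) :
    cwEquiv hn hl hr (nu n l r k v) =
      r • cw n (r ^ 3 * l⁻¹) r⁻¹ k (cwEquiv hn hl hr v) := by
  rw [cw_eq_sigma]
  exact (cwModule hn hl hr).intertwiner_nu hl hr k v

end bijective

/-! ### Homomorphisms from the Artin group -/

/-- The homomorphism from the Artin group to a monoid given by units that satisfy the Artin
relations. -/
def artinLift {A : Type*} [Monoid A] (f : Node n → Aˣ)
    (hc : ∀ i j : Node n, ¬ Adj i.1 j.1 → f i * f j = f j * f i)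
    (hb : ∀ i j : Node n, Adj i.1 j.1 → f i * f j * f i = f j * f i * f j) : Artin n →* A :=
  (Units.coeHom A).comp (PresentedGroup.toGroup (f := f) (by
    intro x hx
    cases hx with
    | comm i j h => simp [hc i j h]
    | braid i j h => simp [hb i j h]))

lemma artinLift_s {A : Type*} [Monoid A] (f : Node n → Aˣ)
    (hc : ∀ i j : Node n, ¬ Adj i.1 j.1 → f i * f j = f j * f i)
    (hb : ∀ i j : Node n, Adj i.1 j.1 → f i * f j * f i = f j * f i * f j) (k : Node n) :
    artinLift f hc hb (Artin.s k) = f k := by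
  rw [artinLift, MonoidHom.comp_apply, Artin.s, PresentedGroup.toGroup.of]
  rfl

section units

variable (n) {l r : F}

/-- The generator `e_k` of the CGW algebra. -/
def CGW.e {n : ℕ} (l r : F) (k : Node n) : CGW n l r :=
  RingQuot.mkAlgHom F (CGWRel n l r) (freeE F k)

lemma CGW.comm {n : ℕ} (l r : F) {i j : Node n} (h : ¬ Adj i.1 j.1) :
    CGW.g l r i * CGW.g l r j = CGW.g l r j * CGW.g l r i := by
  simpa [CGW.g] using RingQuot.mkAlgHom_rel F (CGWRel.comm (l := l) (r := r) i j h)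

lemma CGW.braid {n : ℕ} (l r : F) {i j : Node n} (h : Adj i.1 j.1) :
    CGW.g l r i * CGW.g l r j * CGW.g l r i = CGW.g l r j * CGW.g l r i * CGW.g l r j := by
  simpa [CGW.g] using RingQuot.mkAlgHom_rel F (CGWRel.braid (l := l) (r := r) i j h)

lemma CGW.quad {n : ℕ} (l r : F) (k : Node n) :
    mPar r • CGW.e l r k = l • (CGW.g l r k ^ 2 + mPar r • CGW.g l r k - 1) := by
  simpa [CGW.g, CGW.e] using RingQuot.mkAlgHom_rel F (CGWRel.quad (l := l) (r := r) k)

lemma CGW.deloop {n : ℕ} (l r : F) (k : Node n) :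
    CGW.g l r k * CGW.e l r k = l⁻¹ • CGW.e l r k := by
  simpa [CGW.g, CGW.e] using RingQuot.mkAlgHom_rel F (CGWRel.deloop (l := l) (r := r) k)

/-- The generators `g_k` are invertible. -/
def CGW.gUnit {n : ℕ} {l : F} (r : F) (hl : l ≠ 0) (k : Node n) : (CGW n l r)ˣ where
  val := CGW.g l r k
  -- Since g(m e) = l⁻¹ m e = g² + m g - 1, one has g(g + m - m e) = 1.
  inv := CGW.g l r k + mPar r • 1 - mPar r • CGW.e l r k
  val_inv := by
    have h : CGW.g l r k * (mPar r • CGW.e l r k) =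
        CGW.g l r k ^ 2 + mPar r • CGW.g l r k - 1 := by
      rw [mul_smul_comm, CGW.deloop, smul_comm, CGW.quad, smul_smul, inv_mul_cancel₀ hl, one_smul]
    rw [mul_sub, mul_add, h, mul_smul_comm, mul_one]
    noncomm_ring
  inv_val := by
    have h : (mPar r • CGW.e l r k) * CGW.g l r k =
        CGW.g l r k ^ 2 + mPar r • CGW.g l r k - 1 := by
      -- By the quadratic relation m e_k is a polynomial in g_k, so the two commute.
      have h1 : (mPar r • CGW.e l r k) * CGW.g l r k = CGW.g l r k * (mPar r • CGW.e l r k) := by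
        rw [CGW.quad, smul_mul_assoc, mul_smul_comm]
        simp only [sub_mul, add_mul, mul_sub, mul_add, smul_mul_assoc, mul_smul_comm, one_mul,
          mul_one, pow_two, mul_assoc]
      rw [h1, mul_smul_comm, CGW.deloop, smul_comm, CGW.quad, smul_smul, inv_mul_cancel₀ hl,
        one_smul]
    rw [sub_mul, add_mul, h, smul_mul_assoc, one_mul]
    noncomm_ring

/-- The homomorphism `s_k ↦ g_k` from the Artin group to the CGW algebra. -/
def artinToCGW (r : F) (hl : l ≠ 0) : Artin n →* CGW n l r :=
  artinLift (CGW.gUnit r hl) (fun _ _ h => Units.ext (CGW.comm l r h))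
    fun _ _ h => Units.ext (CGW.braid l r h)

lemma artinToCGW_s (r : F) (hl : l ≠ 0) (k : Node n) :
    artinToCGW n r hl (Artin.s k) = CGW.g l r k := artinLift_s _ _ _ k

/-- The character `s_k ↦ c` of the Artin group. -/
def artinChar (c : Fˣ) : Artin n →* F :=
  artinLift (fun _ => c) (fun _ _ _ => rfl) fun _ _ _ => rfl

lemma artinChar_s (c : Fˣ) (k : Node n) : artinChar n c (Artin.s k) = c := artinLift_s _ _ _ k

end units

/-- The twist of a representation by a character. -/
def twist {G W : Type*} [Group G] [AddCommGroup W] [Module F W] (χ : G →* F)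
    (ρ : Representation F G W) : Representation F G W where
  toFun x := χ x • ρ x
  map_one' := by simp
  map_mul' x y := by rw [map_mul, map_mul, smul_mul_smul_comm]

/-! ### Nonvanishing of the parameters -/

lemma lK_ne_zero : lK ≠ 0 := by
  rw [lK, Ne, FaithfulSMul.algebraMap_eq_zero_iff]
  exact MvPolynomial.X_ne_zero 0

lemma rK_ne_zero : rK ≠ 0 := by
  rw [rK, Ne, FaithfulSMul.algebraMap_eq_zero_iff]
  exact MvPolynomial.X_ne_zero 1

lemma mPar_rK_ne_zero : mPar rK ≠ 0 := by
  intro h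
  have h1 : rK ^ 2 = 1 := by
    have h2 := rK_ne_zero
    rw [mPar, sub_eq_zero] at h
    rw [pow_two]
    nth_rewrite 1 [← h]
    exact inv_mul_cancel₀ h2
  rw [rK, ← map_pow, ← map_one (algebraMap (MvPolynomial (Fin 2) ℚ) K)] at h1
  have h3 := IsFractionRing.injective (MvPolynomial (Fin 2) ℚ) K h1
  -- Evaluation at 2 turns r² = 1 into 4 = 1.
  have h4 := congrArg (MvPolynomial.eval fun _ => (2 : ℚ)) h3
  norm_num at h4

end CGWTypeD

end

open CGWTypeD in
theorem theorem1 (n : ℕ) (hn : 4 ≤ n) :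
    Module.finrank K (V K n) = n ^ 2 - n ∧
    ∃ ρ : CGW n lK rK →ₐ[K] Module.End K (V K n),
      (∀ k : Node n, ρ (CGW.g lK rK k) = nu n lK rK k) ∧
      ∃ ι : Artin n →* CGW n lK rK,
        (∀ k : Node n, ι (Artin.s k) = CGW.g lK rK k) ∧
        -- the restriction of `ρ` to the Artin group, with generators rescaled by `r⁻¹`
        ∃ π : Representation K (Artin n) (V K n),
          (∀ k : Node n, π (Artin.s k) = rK⁻¹ • ρ (ι (Artin.s k))) ∧
          -- the Cohen-Wales representation with parameters `t = r³ l⁻¹` and `r⁻¹`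
          ∃ σ : Representation K (Artin n) (V K n),
            (∀ k : Node n, σ (Artin.s k) = cw n (rK ^ 3 * lK⁻¹) rK⁻¹ k) ∧
            Nonempty (Representation.Equiv π σ) := by
  have h2 : 2 ≤ n := by omega
  have hl := lK_ne_zero
  have hr := rK_ne_zero
  let X := cwEquiv h2 hl hr
  -- The CGW algebra acts through the operators rσ_k; conjugation by the intertwiner turns them into
  -- ν_k.
  let ρ : CGW n lK rK →ₐ[K] Module.End K (V K n) :=
    (X.symm.conjAlgEquiv K).toAlgHom.comp ((cwModule h2 hl hr).rep mPar_rK_ne_zero)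
  have hρ : ∀ k : Node n, ρ (CGW.g lK rK k) = nu n lK rK k := by
    intro k
    refine LinearMap.ext fun v => X.injective ?_
    have h1 : X (nu n lK rK k v) = (cwModule h2 hl hr).g k.1 (X v) :=
      (cwModule h2 hl hr).intertwiner_nu hl hr k v
    rw [h1, ← (cwModule h2 hl hr).rep_g mPar_rK_ne_zero]
    exact X.apply_symm_apply _
  let ι := artinToCGW n rK hl
  have hι : ∀ k, ι (Artin.s k) = CGW.g lK rK k := artinToCGW_s n rK hl
  let π : Representation K (Artin n) (V K n) :=
    twist (artinChar n (Units.mk0 rK hr)⁻¹) ((ρ : CGW n lK rK →* Module.End K (V K n)).comp ι)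
  have hπ : ∀ k, π (Artin.s k) = rK⁻¹ • ρ (ι (Artin.s k)) := by
    intro k
    change artinChar n (Units.mk0 rK hr)⁻¹ (Artin.s k) • ρ (ι (Artin.s k)) = _
    rw [artinChar_s]
    simp
  -- With σ defined by transport, the equivalence with π is automatic; only the identification with
  -- the Cohen–Wales operators on generators remains.
  let σ : Representation K (Artin n) (V K n) :=
    ((X.conjAlgEquiv K).toAlgHom : Module.End K (V K n) →* Module.End K (V K n)).comp π
  have hσ : ∀ x v, X (π x v) = σ x (X v) := fun x v => by
    change _ = X (π x (X.symm (X v)))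
    rw [X.symm_apply_apply]
  refine ⟨finrank_V K n, ρ, hρ, ι, hι, π, hπ, σ, fun k => ?_, ⟨.mk X fun x => ?_⟩⟩
  · refine LinearMap.ext fun v => ?_
    obtain ⟨v, rfl⟩ := X.surjective v
    rw [← hσ, hπ, hι, hρ, LinearMap.smul_apply, map_smul, cwEquiv_nu, smul_smul,
      inv_mul_cancel₀ hr, one_smul]
  · exact LinearMap.ext (hσ x)
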